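/- Throughout, $\kappa$ is the security parameter, simulators and protocol algorithms are (uniform) probabilistic polynomial-time, and distinguishers and adversaries are non-uniform polynomial-time. Let $U=(U_\kappa)$ be a universe of messages of length polynomial in $\kappa$. Let $\mathcal{OT}^n_1=(\mathsf{S.Init},\mathsf{R.GenQuery},\mathsf{S.GenRes},\mathsf{R.Retrieve})$ be a $1$-out-of-$n$ oblivious transfer with polynomial-time algorithms: $\mathsf{S.Init}(1^\kappa)\to pk$; $\mathsf{R.GenQuery}(pk,n,s)\to(q,sp)$, where $q$ is sent to the sender; $\mathsf{S.GenRes}(m_0,\dots,m_{n-1},pk,q)\to res=[e_0,\dots,e_{n-1}]$, which is sent to the receiver; and $\mathsf{R.Retrieve}$, which obtains $m_s$ from the entry $e_s$ and $q,sp,pk,s$. Each entry $e_i=(e_{0,i},\dots,e_{w-1,i})$ consists of $w$ values, where $w=w(\kappa)$ does not depend on $n$. A $1$-out-of-$n$ oblivious transfer *securely computes* $\mathcal F_{\mathcal{OT}^n_1}:((m_0,\dots,m_{n-1}),s)\mapsto(\epsilon,m_s)$ in the presence of semi-honest adversaries if the receiver always outputs $m_s$; some simulator, given only $(m_0,\dots,m_{n-1})$,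 produces an output computationally indistinguishable from the sender's view (input, coins, received messages); and some simulator, given only $n$, $s$ and $m_s$, produces an output computationally indistinguishable from the receiver's view. Indistinguishability holds uniformly over all inputs with $n$ at most any given polynomial in $\kappa$. Let $(\mathsf{KGen},\mathsf{Enc},\mathsf{Dec})$ be an additively homomorphic public-key encryption scheme: for every key pair there are a commutative ring of plaintexts (whose $0$ and $1$ are computable from the public key) and a set of ciphertexts of length polynomial in $\kappa$, containing all fresh encryptions and closed under polynomial-time operations $\stackrel{H}{+}$ and $\stackrel{H}{\times}$, such that decryption is correct, $\mathsf{Dec}(sk,c\stackrel{H}{+}c')=\mathsf{Dec}(sk,c)+\mathsf{Dec}(sk,c')$ and $\mathsf{Dec}(sk,c\stackrel{H}{\times}a)=\mathsf{Dec}(sk,c)\cdot a$ for plaintexts $a$. Assume that the values $e_{j,i}$ are plaintexts for every public key of the scheme. The compiled protocol is as follows. The sender publishes $pk\leftarrow\mathsf{S.Init}(1^\kappa)$. The receiver computes $(q,sp)\leftarrow\mathsf{R.GenQuery}(pk,n,s)$ and $(sk_R,pk_R)\leftarrow\mathsf{KGen}(1^\kappa)$, and sends $pk_R$, $q$ and the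 vector $\boldsymbol b'$ with $b'_i\leftarrow\mathsf{Enc}(pk_R,b_i)$, where $b_s=1$ and $b_i=0$ for $i\ne s$. The sender computes $[e_0,\dots,e_{n-1}]\leftarrow\mathsf{S.GenRes}(m_0,\dots,m_{n-1},pk,q)$ and sends, for $0\le j\le w-1$, the ciphertext $(e_{j,0}\stackrel{H}{\times}b'_0)\stackrel{H}{+}\cdots\stackrel{H}{+}(e_{j,n-1}\stackrel{H}{\times}b'_{n-1})$. The receiver decrypts these $w$ ciphertexts with $sk_R$ and applies $\mathsf{R.Retrieve}$ to the result. If $\mathcal{OT}^n_1$ securely computes $\mathcal F_{\mathcal{OT}^n_1}$ in the presence of semi-honest adversaries and the encryption scheme is IND-CPA secure, then the compiled protocol is a $1$-out-of-$n$ oblivious transfer with polynomial-time algorithms that (i) securely computes $\mathcal F_{\mathcal{OT}^n_1}$ in the presence of semi-honest adversaries, and (ii) has response size $O(1)$ with respect to $n$: the response consists of exactly $w$ ciphertexts, and its total length is at most $K(\kappa)$ for a polynomial $K$ that does not depend on $n$. -/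

import Mathlib

namespace ThinOT

/-! ### Data, programs and running time -/

/-- Finite binary trees: the data on which programs operate. -/
inductive Data : Type
  | nil : Data
  | node (l r : Data) : Data

/-- The size of a tree: its number of leaves and inner nodes. -/
def Data.size : Data → ℕ
  | .nil => 1
  | .node l r => 1 + l.size + r.size

/-- Left component of a tree (`nil` for the leaf). -/
def Data.left : Data → Data
  | .nil => .nil
  | .node l _ => l

/-- Right component of a tree (`nil` for the leaf). -/
def Data.right : Data → Data
  | .nil => .nil
  | .node _ r => r

/-- While-programs over binary trees (a Turing-complete language). Each program maps one tree to
one tree; `cond c f g` runs `g` or `f` according to whether `c` returns the leaf; `loop c f`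
repeats `f` as long as `c` does not return the leaf. -/
inductive Prog : Type
  | id : Prog
  | leaf : Prog
  | left : Prog
  | right : Prog
  | pair (f g : Prog) : Prog
  | comp (f g : Prog) : Prog
  | cond (c f g : Prog) : Prog
  | loop (c f : Prog) : Prog

/-- `Runs P x y t`: started on `x`, the program `P` halts with result `y` after time `t`.
Executing an instruction costs the size of the tree it is executed on (so that copying is paid
for), in addition to the cost of its parts. This cost is polynomially related to the number of
steps of a Turing machine. -/
inductive Runs : Prog → Data → Data → ℕ → Prop
  | id (x : Data) : Runs .id x x x.size
  | leaf (x : Data) : Runs .leaf x .nil x.size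
  | left (x : Data) : Runs .left x x.left x.size
  | right (x : Data) : Runs .right x x.right x.size
  | pair {f g : Prog} {x y z : Data} {t u : ℕ} :
      Runs f x y t → Runs g x z u → Runs (.pair f g) x (.node y z) (x.size + t + u)
  | comp {f g : Prog} {x y z : Data} {t u : ℕ} :
      Runs g x y t → Runs f y z u → Runs (.comp f g) x z (x.size + t + u)
  | condTrue {c f g : Prog} {x a b y : Data} {t u : ℕ} :
      Runs c x (.node a b) t → Runs f x y u → Runs (.cond c f g) x y (x.size + t + u)
  | condFalse {c f g : Prog} {x y : Data} {t u : ℕ} :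
      Runs c x .nil t → Runs g x y u → Runs (.cond c f g) x y (x.size + t + u)
  | loopStop {c f : Prog} {x : Data} {t : ℕ} :
      Runs c x .nil t → Runs (.loop c f) x x (x.size + t)
  | loopStep {c f : Prog} {x a b y z : Data} {t u v : ℕ} :
      Runs c x (.node a b) t → Runs f x y u → Runs (.loop c f) y z v →
      Runs (.loop c f) x z (x.size + t + u + v)

/-- Types whose elements are written as trees. -/
class Coded (α : Type) where
  code : α → Data


open Coded (code)

instance : Coded Data := ⟨fun x => x⟩

instance : Coded Bool := ⟨fun b => if b then .node .nil .nil else .nil⟩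

/-- Unary notation. -/
def unary : ℕ → Data
  | 0 => .nil
  | k + 1 => .node .nil (unary k)

/-- Natural numbers (security parameter, number of messages, index, lengths) are in unary. -/
instance : Coded ℕ := ⟨unary⟩

/-- A list of trees as one tree. -/
def listData : List Data → Data
  | [] => .nil
  | x :: xs => .node x (listData xs)

instance {α : Type} [Coded α] : Coded (List α) := ⟨fun l => listData (l.map code)⟩

instance {α β : Type} [Coded α] [Coded β] : Coded (α × β) :=
  ⟨fun x => .node (code x.1) (code x.2)⟩

/-- `f` is computed, on all inputs from `S`, by one program in time polynomial in the size of
the input. -/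
def PolyTimeOn {α β : Type} [Coded α] [Coded β] (S : Set α) (f : α → β) : Prop :=
  ∃ P : Prog, ∃ p : Polynomial ℕ, ∀ x ∈ S,
    ∃ t ≤ p.eval (code x).size, Runs P (code x) (code (f x)) t

/-- `f` is computed in polynomial time on all inputs. -/
def PolyTime {α β : Type} [Coded α] [Coded β] (f : α → β) : Prop :=
  PolyTimeOn Set.univ f

/-! ### Randomness and computational indistinguishability -/

/-- `ℓ` independent uniform coin tosses. -/
noncomputable def bits (ℓ : ℕ) : PMF (List Bool) :=
  (PMF.uniformOfFintype (Fin ℓ → Bool)).map List.ofFn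

/-- Negligible: smaller than every inverse polynomial in the security parameter. -/
def Negligible (μ : ℕ → ℝ) : Prop :=
  Asymptotics.SuperpolynomialDecay Filter.atTop (fun κ : ℕ => (κ : ℝ)) μ

/-- The probability that `D`, given `1^κ` and the advice `z`, accepts a sample of `X`. -/
noncomputable def acceptProb (D : ℕ × Data × Data → Bool) (κ : ℕ) (z : Data) (X : PMF Data) : ℝ :=
  ((X.map fun x => D (κ, z, x)) true).toReal

/-- Computational indistinguishability of two ensembles indexed by the security parameter `κ` and
by inputs `i ∈ I κ`, for non-uniform polynomial-time distinguishers: a polynomial-time program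
with an advice string of polynomial length, which may depend on `κ` and on `i` (and in which
coins of the distinguisher can be hard-wired). -/
def CompIndist {ι : Type} (I : ℕ → Set ι) (X Y : ℕ → ι → PMF Data) : Prop :=
  ∀ D : ℕ × Data × Data → Bool, PolyTime D → ∀ p : Polynomial ℕ,
    ∃ μ : ℕ → ℝ, Negligible μ ∧ ∀ κ, ∀ i ∈ I κ, ∀ z : Data, z.size ≤ p.eval κ →
      |acceptProb D κ z (X κ i) - acceptProb D κ z (Y κ i)| ≤ μ κ

/-! ### Additively homomorphic encryption -/

/-- An additively homomorphic public-key encryption scheme. For each public key there are a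
commutative ring of plaintexts and a set of ciphertexts of bounded length, which contains the
fresh encryptions and is closed under the two homomorphic operations. All algorithms receive the
security parameter; the randomised ones receive their coins as last argument. -/
structure AHE where
  kgenCoins : ℕ → ℕ
  encCoins : ℕ → ℕ
  /-- key generation, returns `(sk, pk)` -/
  kgen : ℕ → List Bool → Data × Data
  /-- encryption, `enc κ pk m r` -/
  enc : ℕ → Data → Data → List Bool → Data
  /-- decryption, `dec κ sk c` -/
  dec : ℕ → Data → Data → Data
  /-- homomorphic addition of two ciphertexts, `hadd κ pk c c'` -/
  hadd : ℕ → Data → Data → Data → Data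
  /-- homomorphic multiplication of a ciphertext by a plaintext, `hmul κ pk c a` -/
  hmul : ℕ → Data → Data → Data → Data
  /-- plaintext space of a public key -/
  Plain : ℕ → Data → Set Data
  plainRing : ∀ κ pk, CommRing (Plain κ pk)
  /-- ciphertext space of a public key -/
  Cipher : ℕ → Data → Set Data
  enc_spec : ∀ κ r, r.length = kgenCoins κ →
    ∀ (a : Plain κ (kgen κ r).2) (r' : List Bool), r'.length = encCoins κ →
      enc κ (kgen κ r).2 a r' ∈ Cipher κ (kgen κ r).2 ∧
      dec κ (kgen κ r).1 (enc κ (kgen κ r).2 a r') = a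
  hadd_spec : ∀ κ r, r.length = kgenCoins κ →
    ∀ c ∈ Cipher κ (kgen κ r).2, ∀ c' ∈ Cipher κ (kgen κ r).2,
    ∀ a a' : Plain κ (kgen κ r).2,
      dec κ (kgen κ r).1 c = a → dec κ (kgen κ r).1 c' = a' →
      hadd κ (kgen κ r).2 c c' ∈ Cipher κ (kgen κ r).2 ∧
      dec κ (kgen κ r).1 (hadd κ (kgen κ r).2 c c') = (a + a' : Plain κ (kgen κ r).2)
  hmul_spec : ∀ κ r, r.length = kgenCoins κ →
    ∀ c ∈ Cipher κ (kgen κ r).2, ∀ a a' : Plain κ (kgen κ r).2,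
      dec κ (kgen κ r).1 c = a →
      hmul κ (kgen κ r).2 c a' ∈ Cipher κ (kgen κ r).2 ∧
      dec κ (kgen κ r).1 (hmul κ (kgen κ r).2 c a') = (a * a' : Plain κ (kgen κ r).2)
  cipher_size : ∃ B : Polynomial ℕ, ∀ κ r, r.length = kgenCoins κ →
    ∀ c ∈ Cipher κ (kgen κ r).2, c.size ≤ B.eval κ
  kgenCoins_polyTime : PolyTime kgenCoins
  encCoins_polyTime : PolyTime encCoins
  kgen_polyTime : PolyTime fun x : ℕ × List Bool => kgen x.1 x.2
  enc_polyTime : PolyTime fun x : ℕ × Data × Data × List Bool => enc x.1 x.2.1 x.2.2.1 x.2.2.2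
  dec_polyTime : PolyTime fun x : ℕ × Data × Data => dec x.1 x.2.1 x.2.2
  hadd_polyTime : PolyTime fun x : ℕ × Data × Data × Data => hadd x.1 x.2.1 x.2.2.1 x.2.2.2
  hmul_polyTime : PolyTime fun x : ℕ × Data × Data × Data => hmul x.1 x.2.1 x.2.2.1 x.2.2.2
  /-- the zero and the unit of the plaintext ring can be computed from the public key -/
  bit_polyTime : PolyTime fun x : ℕ × Data × Bool =>
    (if x.2.2 then ((plainRing x.1 x.2.1).one : Plain x.1 x.2.1)
      else ((plainRing x.1 x.2.1).zero : Plain x.1 x.2.1) : Data)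

attribute [instance] AHE.plainRing

namespace AHE

variable (A : AHE)

/-- A bit as a plaintext: the unit or the zero of the plaintext ring. -/
def bit (κ : ℕ) (pk : Data) (b : Bool) : Data :=
  if b then ((1 : A.Plain κ pk) : Data) else ((0 : A.Plain κ pk) : Data)

open Classical in
/-- The chosen-plaintext experiment. The adversary sees the public key, chooses two plaintexts,
receives the encryption of one of them, chosen by a fair coin `b`, and guesses `b`. The result is
`true` if the two plaintexts were admissible and the guess is right. -/
noncomputable def cpaExperiment (A₁ : ℕ × Data × Data → Data × Data × Data)
    (A₂ : ℕ × Data × Data × Data → Bool) (κ : ℕ) (z : Data) : PMF Bool := do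
  let r ← bits (A.kgenCoins κ)
  let pk := (A.kgen κ r).2
  let (m₀, m₁, st) := A₁ (κ, z, pk)
  let b ← PMF.uniformOfFintype Bool
  let r' ← bits (A.encCoins κ)
  let c := A.enc κ pk (if b then m₁ else m₀) r'
  pure (decide (m₀ ∈ A.Plain κ pk ∧ m₁ ∈ A.Plain κ pk) && (A₂ (κ, z, st, c) == b))

/-- Indistinguishability under chosen-plaintext attacks by non-uniform polynomial-time
adversaries (polynomial-time programs with an advice string `z` of polynomial length). -/
def INDCPA : Prop :=
  ∀ (A₁ : ℕ × Data × Data → Data × Data × Data) (A₂ : ℕ × Data × Data × Data → Bool),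
    PolyTime A₁ → PolyTime A₂ → ∀ p : Polynomial ℕ,
      ∃ μ : ℕ → ℝ, Negligible μ ∧ ∀ κ, ∀ z : Data, z.size ≤ p.eval κ →
        (A.cpaExperiment A₁ A₂ κ z true).toReal ≤ 1 / 2 + μ κ

end AHE

/-! ### 1-out-of-n oblivious transfer -/

/-- The functionality `((m₀, …, mₙ₋₁), s) ↦ (ε, m_s)`. -/
def otFun (m : List Data) (s : ℕ) : Unit × Data :=
  ((), m.getD s .nil)

/-- A 1-out-of-n oblivious transfer in its usual syntax, with queries in `Q`, receiver's secret
parameters in `Sp` and responses in `Res`. Randomised algorithms receive their coins as last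
argument. -/
structure OT (Q Sp Res : Type) where
  initCoins : ℕ → ℕ
  queryCoins : ℕ → ℕ → ℕ
  resCoins : ℕ → ℕ → ℕ
  /-- `S.Init(1^κ) → pk` -/
  init : ℕ → List Bool → Data
  /-- `R.GenQuery(pk, n, s) → (q, sp)` -/
  genQuery : ℕ → Data → ℕ → ℕ → List Bool → Q × Sp
  /-- `S.GenRes(m₀, …, mₙ₋₁, pk, q) → res` -/
  genRes : ℕ → List Data → Data → Q → List Bool → Res
  /-- `R.Retrieve(res, q, sp, pk, s) → m_s` -/
  retrieve : ℕ → Res → Q → Sp → Data → ℕ → Data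

/-- The inputs and the coins of one execution: number of messages, index, messages, sender's
coins for the initialisation, receiver's coins, sender's coins for the response. -/
structure Exec where
  n : ℕ
  s : ℕ
  m : List Data
  r₀ : List Bool
  r₁ : List Bool
  r₂ : List Bool

namespace OT

variable {Q Sp Res : Type} (P : OT Q Sp Res)

/-- The sender's public key in an execution. -/
def pk (κ : ℕ) (e : Exec) : Data := P.init κ e.r₀

/-- The receiver's query in an execution. -/
def query (κ : ℕ) (e : Exec) : Q := (P.genQuery κ (P.pk κ e) e.n e.s e.r₁).1

/-- The receiver's secret parameter in an execution. -/
def secret (κ : ℕ) (e : Exec) : Sp := (P.genQuery κ (P.pk κ e) e.n e.s e.r₁).2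

/-- The sender's response in an execution. -/
def response (κ : ℕ) (e : Exec) : Res := P.genRes κ e.m (P.pk κ e) (P.query κ e) e.r₂

/-- The receiver's output in an execution. -/
def output (κ : ℕ) (e : Exec) : Data :=
  P.retrieve κ (P.response κ e) (P.query κ e) (P.secret κ e) (P.pk κ e) e.s

/-- Executions with messages from the universe `U κ`, an index in range, and coin strings of the
prescribed lengths. -/
def Honest (U : ℕ → Set Data) (κ : ℕ) (e : Exec) : Prop :=
  e.s < e.n ∧ e.m.length = e.n ∧ (∀ x ∈ e.m, x ∈ U κ) ∧
    e.r₀.length = P.initCoins κ ∧ e.r₁.length = P.queryCoins κ e.n ∧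
    e.r₂.length = P.resCoins κ e.n

/-- The four algorithms run in polynomial time in the executions of the protocol, and the
numbers of coins they toss are computable in polynomial time. -/
structure Efficient [Coded Q] [Coded Sp] [Coded Res] (U : ℕ → Set Data) : Prop where
  initCoins : PolyTime P.initCoins
  queryCoins : PolyTime fun x : ℕ × ℕ => P.queryCoins x.1 x.2
  resCoins : PolyTime fun x : ℕ × ℕ => P.resCoins x.1 x.2
  init : PolyTimeOn {x | ∃ κ e, P.Honest U κ e ∧ x = (κ, e.r₀)}
    fun x : ℕ × List Bool => P.init x.1 x.2
  genQuery : PolyTimeOn {x | ∃ κ e, P.Honest U κ e ∧ x = (κ, P.pk κ e, e.n, e.s, e.r₁)}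
    fun x : ℕ × Data × ℕ × ℕ × List Bool =>
      P.genQuery x.1 x.2.1 x.2.2.1 x.2.2.2.1 x.2.2.2.2
  genRes : PolyTimeOn {x | ∃ κ e, P.Honest U κ e ∧ x = (κ, e.m, P.pk κ e, P.query κ e, e.r₂)}
    fun x : ℕ × List Data × Data × Q × List Bool =>
      P.genRes x.1 x.2.1 x.2.2.1 x.2.2.2.1 x.2.2.2.2
  retrieve : PolyTimeOn
    {x | ∃ κ e, P.Honest U κ e ∧
      x = (κ, P.response κ e, P.query κ e, P.secret κ e, P.pk κ e, e.s)}
    fun x : ℕ × Res × Q × Sp × Data × ℕ =>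
      P.retrieve x.1 x.2.1 x.2.2.1 x.2.2.2.1 x.2.2.2.2.1 x.2.2.2.2.2

/-- The receiver always obtains its output of the functionality. -/
def Correct (U : ℕ → Set Data) : Prop :=
  ∀ κ e, P.Honest U κ e → P.output κ e = (otFun e.m e.s).2

/-- The sender's view: its input `m`, its coins and the message it receives. -/
noncomputable def senderView [Coded Q] (κ : ℕ) (m : List Data) (s : ℕ) : PMF Data := do
  let r₀ ← bits (P.initCoins κ)
  let r₁ ← bits (P.queryCoins κ m.length)
  let r₂ ← bits (P.resCoins κ m.length)
  pure (code (m, (r₀, r₂), P.query κ ⟨m.length, s, m, r₀, r₁, r₂⟩))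

/-- The receiver's view: its input (index and number of messages), its coins and the messages it
receives. -/
noncomputable def receiverView [Coded Res] (κ : ℕ) (m : List Data) (s : ℕ) : PMF Data := do
  let r₀ ← bits (P.initCoins κ)
  let r₁ ← bits (P.queryCoins κ m.length)
  let r₂ ← bits (P.resCoins κ m.length)
  pure (code ((m.length, s), r₁, P.pk κ ⟨m.length, s, m, r₀, r₁, r₂⟩,
    P.response κ ⟨m.length, s, m, r₀, r₁, r₂⟩))

end OT

/-- The pairs of inputs for security parameter `κ` with at most `p κ` messages. -/
def inputs (U : ℕ → Set Data) (p : Polynomial ℕ) (κ : ℕ) : Set (List Data × ℕ) :=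
  {i | i.2 < i.1.length ∧ (∀ x ∈ i.1, x ∈ U κ) ∧ i.1.length ≤ p.eval κ}

namespace OT

variable {Q Sp Res : Type} (P : OT Q Sp Res)

/-- Some probabilistic polynomial-time simulator, given the sender's input only (its output is
empty), simulates the sender's view, for every polynomial number of messages. -/
def SenderSimulatable [Coded Q] (U : ℕ → Set Data) : Prop :=
  ∃ (ℓ : ℕ → ℕ → ℕ) (Sim : ℕ → List Data → List Bool → Data),
    PolyTime (fun x : ℕ × ℕ => ℓ x.1 x.2) ∧
    PolyTimeOn {x | (∀ y ∈ x.2.1, y ∈ U x.1) ∧ x.2.2.length = ℓ x.1 x.2.1.length}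
      (fun x : ℕ × List Data × List Bool => Sim x.1 x.2.1 x.2.2) ∧
    ∀ p : Polynomial ℕ, CompIndist (inputs U p)
      (fun κ i => (bits (ℓ κ i.1.length)).map (Sim κ i.1))
      (fun κ i => P.senderView κ i.1 i.2)

/-- Some probabilistic polynomial-time simulator, given the receiver's input `(n, s)` and its
output of the functionality only, simulates the receiver's view, for every polynomial number of
messages. -/
def ReceiverSimulatable [Coded Res] (U : ℕ → Set Data) : Prop :=
  ∃ (ℓ : ℕ → ℕ → ℕ) (Sim : ℕ → ℕ → ℕ → Data → List Bool → Data),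
    PolyTime (fun x : ℕ × ℕ => ℓ x.1 x.2) ∧
    PolyTimeOn {x | x.2.2.1 < x.2.1 ∧ x.2.2.2.1 ∈ U x.1 ∧ x.2.2.2.2.length = ℓ x.1 x.2.1}
      (fun x : ℕ × ℕ × ℕ × Data × List Bool =>
        Sim x.1 x.2.1 x.2.2.1 x.2.2.2.1 x.2.2.2.2) ∧
    ∀ p : Polynomial ℕ, CompIndist (inputs U p)
      (fun κ i => (bits (ℓ κ i.1.length)).map (Sim κ i.1.length i.2 (otFun i.1 i.2).2))
      (fun κ i => P.receiverView κ i.1 i.2)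

/-- `P` securely computes the functionality `otFun`, on messages from `U`, in the presence of
semi-honest adversaries. -/
def SecurelyComputes [Coded Q] [Coded Res] (U : ℕ → Set Data) : Prop :=
  P.Correct U ∧ P.SenderSimulatable U ∧ P.ReceiverSimulatable U

end OT

/-- A 1-out-of-n oblivious transfer whose response is a vector `[e₀, …, eₙ₋₁]`, each entry being a
list of values, and whose receiver extracts `m_s` from the entry `e_s`. -/
structure VecOT where
  initCoins : ℕ → ℕ
  queryCoins : ℕ → ℕ → ℕ
  resCoins : ℕ → ℕ → ℕ
  init : ℕ → List Bool → Data
  genQuery : ℕ → Data → ℕ → ℕ → List Bool → Data × Data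
  genRes : ℕ → List Data → Data → Data → List Bool → List (List Data)
  /-- extraction of `m_s` from the entry `e_s` of the response -/
  retrieveEntry : ℕ → List Data → Data → Data → Data → ℕ → Data

namespace VecOT

/-- The oblivious transfer itself: the receiver is sent the whole vector. -/
def toOT (P : VecOT) : OT Data Data (List (List Data)) where
  initCoins := P.initCoins
  queryCoins := P.queryCoins
  resCoins := P.resCoins
  init := P.init
  genQuery := P.genQuery
  genRes := P.genRes
  retrieve κ res q sp pk s := P.retrieveEntry κ (res.getD s []) q sp pk s

/-- The algorithms run in polynomial time, in particular the extraction from one entry. -/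
structure Efficient (P : VecOT) (U : ℕ → Set Data) : Prop where
  toOT : P.toOT.Efficient U
  retrieveEntry : PolyTimeOn
    {x | ∃ κ e, P.toOT.Honest U κ e ∧
      x = (κ, (P.toOT.response κ e).getD e.s [], P.toOT.query κ e, P.toOT.secret κ e,
        P.toOT.pk κ e, e.s)}
    fun x : ℕ × List Data × Data × Data × Data × ℕ =>
      P.retrieveEntry x.1 x.2.1 x.2.2.1 x.2.2.2.1 x.2.2.2.2.1 x.2.2.2.2.2

/-- The response has `n` entries, each consisting of `w κ` values, and these values are plaintexts
of the encryption scheme. -/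
def Fits (P : VecOT) (A : AHE) (U : ℕ → Set Data) (w : ℕ → ℕ) : Prop :=
  ∀ κ e, P.toOT.Honest U κ e →
    (P.toOT.response κ e).length = e.n ∧
    ∀ v ∈ P.toOT.response κ e, v.length = w κ ∧
      ∀ x ∈ v, ∀ r : List Bool, r.length = A.kgenCoins κ → x ∈ A.Plain κ (A.kgen κ r).2

end VecOT

/-! ### The compiler -/

/-- The encrypted one-hot vector of length `n` with the unit at position `s`; the `i`-th
encryption uses the `i`-th block of the coins. -/
def encOneHot (A : AHE) (κ : ℕ) (pkR : Data) (n s : ℕ) (r : List Bool) : List Data :=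
  (List.range n).map fun i =>
    A.enc κ pkR (A.bit κ pkR (decide (i = s)))
      ((r.drop (i * A.encCoins κ)).take (A.encCoins κ))

/-- Homomorphic, coordinatewise sum of a list of vectors of ciphertexts. -/
def hsum (A : AHE) (κ : ℕ) (pkR : Data) : List (List Data) → List Data
  | [] => []
  | v :: vs => vs.foldl (List.zipWith (A.hadd κ pkR)) v

/-- The homomorphic inner product of the response with the encrypted vector; each entry of the
response is multiplied value by value. -/
def compress (A : AHE) (κ : ℕ) (pkR : Data) (b : List Data) (res : List (List Data)) :
    List Data :=
  hsum A κ pkR (List.zipWith (fun c e => e.map fun x => A.hmul κ pkR c x) b res)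

/-- The compiled protocol. Its query is `(pk_R, q, b')`, its secret parameter `(sp, sk_R)`; the
receiver's coins are those for `q`, for the key pair, and for the `n` encryptions. -/
def compile (P : VecOT) (A : AHE) : OT (Data × Data × List Data) (Data × Data) (List Data) where
  initCoins := P.initCoins
  queryCoins κ n := P.queryCoins κ n + (A.kgenCoins κ + n * A.encCoins κ)
  resCoins := P.resCoins
  init := P.init
  genQuery κ pk n s r :=
    let r₁ := r.take (P.queryCoins κ n)
    let r₂ := (r.drop (P.queryCoins κ n)).take (A.kgenCoins κ)
    let r₃ := (r.drop (P.queryCoins κ n)).drop (A.kgenCoins κ)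
    let (q, sp) := P.genQuery κ pk n s r₁
    let (skR, pkR) := A.kgen κ r₂
    ((pkR, q, encOneHot A κ pkR n s r₃), (sp, skR))
  genRes κ m pk q r := compress A κ q.1 q.2.2 (P.genRes κ m pk q.2.1 r)
  retrieve κ res q sp pk s :=
    P.retrieveEntry κ (res.map (A.dec κ sp.2)) q.2.1 sp.1 pk s

end ThinOT

open ThinOT

namespace ThinOT

open ThinOT.Coded (code)

/-! ### Polynomial bounds -/

/-! Correctness. Multiplying entry `i` of the response by an encryption of `b_i` gives encryptions
of `e_i` for `i = s` and of zero otherwise, so the homomorphic sum decrypts, value by value, to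
`e_s` (`compress_spec`). The response is therefore one ciphertext per value of `e_s`. Ciphertexts
have polynomial length, and `w κ` is polynomial because a one-message execution already has a
response of polynomial size (`width_bound`); neither bound involves `n`.

Receiver. Given its key pair and encrypted vector, the compressed response is a function of the
uncompressed one. The compiled view is thus exactly a post-processing of the underlying view with
independent data (`receiverView_compile`), and the simulator applies the same post-processing to a
simulated view. Encryption security plays no role here.

Sender. The compiled query adds a public key and an encrypted one-hot vector. The simulator attaches
encryptions of zero to the simulated underlying view. Passing to the real underlying view is again
post-processing (`CompIndist.bind_map`). Then the ciphertext at position `s` changes from zero to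
one. As the two vectors differ in one place, a single IND-CPA challenge suffices and no hybrid over
`n` is needed: the underlying view and all other coins go into the advice
(`keyedVector_bind_eq_plugAdvice`, `AHE.INDCPA.compIndist`).

Efficiency. The relation `PT` gives a calculus for building while-programs with polynomial running
time. Iterated homomorphic additions could blow up on malformed input, which simulators and
distinguishers may feed them, so the programs cap every intermediate ciphertext at the length bound
(`cappedCompress`). On honest data the cap never acts. -/

theorem eval_le_eval (p : Polynomial ℕ) {x y : ℕ} (h : x ≤ y) : p.eval x ≤ p.eval y := by
  rw [Polynomial.eval_eq_sum_range, Polynomial.eval_eq_sum_range]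
  gcongr

/-- `f` is bounded by a polynomial in `a`. -/
def PolyBound {ι : Type} (a f : ι → ℕ) : Prop :=
  ∃ p : Polynomial ℕ, ∀ i, f i ≤ p.eval (a i)

namespace PolyBound

variable {ι ι' : Type} {a f g : ι → ℕ}

theorem self : PolyBound a a := ⟨Polynomial.X, fun i => by simp⟩

theorem const (c : ℕ) : PolyBound a fun _ => c := ⟨Polynomial.C c, fun i => by simp⟩

theorem add (hf : PolyBound a f) (hg : PolyBound a g) : PolyBound a fun i => f i + g i := by
  obtain ⟨p, hp⟩ := hf
  obtain ⟨q, hq⟩ := hg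
  exact ⟨p + q, fun i => by simpa using Nat.add_le_add (hp i) (hq i)⟩

theorem mul (hf : PolyBound a f) (hg : PolyBound a g) : PolyBound a fun i => f i * g i := by
  obtain ⟨p, hp⟩ := hf
  obtain ⟨q, hq⟩ := hg
  exact ⟨p * q, fun i => by simpa using Nat.mul_le_mul (hp i) (hq i)⟩

theorem eval (p : Polynomial ℕ) (hf : PolyBound a f) : PolyBound a fun i => p.eval (f i) := by
  obtain ⟨q, hq⟩ := hf
  exact ⟨p.comp q, fun i => by simpa using eval_le_eval p (hq i)⟩

theorem mono (hf : PolyBound a f) (h : ∀ i, g i ≤ f i) : PolyBound a g := by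
  obtain ⟨p, hp⟩ := hf
  exact ⟨p, fun i => (h i).trans (hp i)⟩

theorem trans (hf : PolyBound a f) (hg : PolyBound f g) : PolyBound a g := by
  obtain ⟨p, hp⟩ := hg
  exact (hf.eval p).mono hp

theorem reindex (hf : PolyBound a f) (e : ι' → ι) :
    PolyBound (fun j => a (e j)) fun j => f (e j) := by
  obtain ⟨p, hp⟩ := hf
  exact ⟨p, fun j => hp (e j)⟩

end PolyBound

/-! ### Sizes -/

theorem Data.one_le_size (x : Data) : 1 ≤ x.size := by
  cases x <;> simp [Data.size]; omega

theorem Data.left_size_le (x : Data) : x.left.size ≤ x.size := by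
  cases x <;> simp [Data.size, Data.left]; omega

theorem Data.right_size_le (x : Data) : x.right.size ≤ x.size := by
  cases x <;> simp [Data.size, Data.right]

/-- Output is paid for: in the `pair` case the new inner node is covered by the charge `x.size ≥ 1`.
Hence every running-time bound is also a bound on the size of the result. -/
theorem Runs.size_le {P : Prog} {x y : Data} {t : ℕ} (h : Runs P x y t) : y.size ≤ t := by
  induction h with
  | id x => exact le_rfl
  | leaf x => exact x.one_le_size
  | left x => exact x.left_size_le
  | right x => exact x.right_size_le
  | @pair f g x y z t u _ _ h1 h2 =>
    have := x.one_le_size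
    simp only [Data.size]; omega
  | _ => omega

theorem size_unary (n : ℕ) : (unary n).size = 2 * n + 1 := by
  induction n with
  | zero => rfl
  | succ n ih => simp [unary, Data.size, ih]; omega

theorem size_listData (l : List Data) :
    (listData l).size = 1 + (l.map fun x => 1 + x.size).sum := by
  induction l with
  | nil => rfl
  | cons x l ih => simp [listData, Data.size, ih]; omega

theorem size_listData_le {l : List Data} {n M : ℕ} (hn : l.length ≤ n)
    (h : ∀ x ∈ l, x.size ≤ M) : (listData l).size ≤ 1 + n * (1 + M) := by
  rw [size_listData]
  have := List.sum_le_card_nsmul (l.map fun x => 1 + x.size) (1 + M) (by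
    intro y hy
    obtain ⟨x, hx, rfl⟩ := List.mem_map.1 hy
    have := h x hx
    omega)
  simp only [List.length_map, smul_eq_mul] at this
  have h2 : l.length * (1 + M) ≤ n * (1 + M) := Nat.mul_le_mul_right _ hn
  omega

theorem length_le_size_listData (l : List Data) : l.length ≤ (listData l).size := by
  induction l with
  | nil => simp
  | cons x l ih => simp [listData, Data.size]; omega

theorem size_le_size_listData {l : List Data} {x : Data} (h : x ∈ l) :
    x.size ≤ (listData l).size := by
  induction l with
  | nil => simp at h
  | cons y l ih =>
    rcases List.mem_cons.1 h with rfl | h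
    · simp [listData, Data.size]; omega
    · have := ih h
      simp [listData, Data.size]; omega

theorem size_listData_drop_le (l : List Data) (k : ℕ) :
    (listData (l.drop k)).size ≤ (listData l).size := by
  induction l generalizing k with
  | nil => simp
  | cons x l ih =>
    cases k with
    | zero => simp
    | succ k =>
      have := ih k
      simp [listData, Data.size]; omega

/-- The entries of a tree read as a list. -/
def Data.toList : Data → List Data
  | .nil => []
  | .node x y => x :: y.toList

-- Trees and lists of trees are in bijection, so programs on lists are meaningful on every tree,
-- including malformed input.
@[simp] theorem listData_toList (d : Data) : listData d.toList = d := by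
  induction d with
  | nil => rfl
  | node x y _ ih => simp [Data.toList, listData, ih]

@[simp] theorem toList_listData (l : List Data) : (listData l).toList = l := by
  induction l with
  | nil => rfl
  | cons x l ih => simp [Data.toList, listData, ih]

/-- Numbers are lists of leaves; programs on lists thereby provide loops with a counter and
arithmetic. -/
theorem unary_eq_listData (n : ℕ) : unary n = listData (List.replicate n .nil) := by
  induction n with
  | zero => rfl
  | succ n ih => simp [unary, List.replicate_succ, listData, ih]

/-! ### Polynomial-time computable families -/

/-- One program maps `a i` to `b i`, for every index `i`, in time polynomial in the size of
`a i`. -/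
def PT {ι : Type} (a b : ι → Data) : Prop :=
  ∃ (P : Prog) (t : ι → ℕ), PolyBound (fun i => (a i).size) t ∧ ∀ i, Runs P (a i) (b i) (t i)

namespace PT

variable {ι ι' : Type} {a b c d : ι → Data}

theorem size_bound (h : PT a b) : PolyBound (fun i => (a i).size) fun i => (b i).size := by
  obtain ⟨P, t, ht, hr⟩ := h
  exact ht.mono fun i => (hr i).size_le

theorem reindex (h : PT a b) (e : ι' → ι) : PT (fun j => a (e j)) fun j => b (e j) := by
  obtain ⟨P, t, ht, hr⟩ := h
  exact ⟨P, _, ht.reindex e, fun j => hr (e j)⟩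

theorem congr (h : PT a b) (e : ∀ i, b i = c i) : PT a c := by
  rwa [← funext e]

theorem self : PT a a := ⟨.id, _, .self, fun _ => .id _⟩

theorem nil : PT a fun _ => .nil := ⟨.leaf, _, .self, fun _ => .leaf _⟩

/-- The second program is polynomial in the size of `b i`, which is itself polynomial in the size of
`a i` by `size_bound`. -/
theorem trans (h : PT a b) (h' : PT b c) : PT a c := by
  have hs := h.size_bound
  obtain ⟨P, t, ht, hr⟩ := h
  obtain ⟨Q, u, hu, hr'⟩ := h'
  exact ⟨.comp Q P, _, (PolyBound.self.add ht).add (hs.trans hu), fun i => .comp (hr i) (hr' i)⟩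

theorem left (h : PT a b) : PT a fun i => (b i).left :=
  h.trans ⟨.left, _, .self, fun _ => .left _⟩

theorem right (h : PT a b) : PT a fun i => (b i).right :=
  h.trans ⟨.right, _, .self, fun _ => .right _⟩

theorem node (h : PT a b) (h' : PT a c) : PT a fun i => .node (b i) (c i) := by
  obtain ⟨P, t, ht, hr⟩ := h
  obtain ⟨Q, u, hu, hr'⟩ := h'
  exact ⟨.pair P Q, _, (PolyBound.self.add ht).add hu, fun i => .pair (hr i) (hr' i)⟩

theorem const (d : Data) : PT a fun _ => d := by
  induction d with
  | nil => exact nil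
  | node x y hx hy => exact hx.node hy

open Classical in
theorem ite_nil (h : PT a b) (hc : PT a c) (hd : PT a d) :
    PT a fun i => if b i = .nil then c i else d i := by
  obtain ⟨P, t, ht, hr⟩ := h
  obtain ⟨Q, u, hu, hr'⟩ := hc
  obtain ⟨R, v, hv, hr''⟩ := hd
  refine ⟨.cond P R Q, fun i => (a i).size + t i + (if b i = .nil then u i else v i), ?_, ?_⟩
  · refine ((PolyBound.self.add ht).add (hu.add hv)).mono fun i => ?_
    split <;> omega
  · intro i
    have := hr i
    by_cases hb : b i = .nil
    · rw [hb] at this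
      simpa [hb] using Runs.condFalse this (hr' i)
    · obtain ⟨x, y, hxy⟩ : ∃ x y, b i = .node x y := by
        cases hbi : b i with
        | nil => exact absurd hbi hb
        | node x y => exact ⟨x, y, rfl⟩
      rw [hxy] at this
      simpa [hb] using Runs.condTrue this (hr'' i)

theorem ite_bool {e : ι → Bool} (h : PT a fun i => code (e i)) (hc : PT a c) (hd : PT a d) :
    PT a fun i => if e i then c i else d i := by
  classical
  refine (h.ite_nil hd hc).congr fun i => ?_
  cases e i <;> simp [code]

/-- Weakening of the environment. -/
theorem fst (h : PT a b) (e : ι' → ι) (x : ι' → Data) :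
    PT (fun j => .node (a (e j)) (x j)) fun j => b (e j) :=
  (show PT (fun j => Data.node (a (e j)) (x j)) (fun j => a (e j)) from self.left).trans
    (h.reindex e)

/-! #### Loops -/

/-- The test and the body need only behave well on the states `s i k` that actually occur. The
hypothesis `hb` is essential: a polynomial-time body may enlarge its state in every round, and the
sizes would then compound beyond any polynomial. -/
theorem loop {s : ι → ℕ → Data} {N : ι → ℕ}
    (hc : PT (fun p : Σ i, Fin (N i + 1) => s p.1 p.2)
      fun p => if (p.2 : ℕ) < N p.1 then .node .nil .nil else .nil)
    (hs : PT (fun p : Σ i, Fin (N i) => s p.1 p.2) fun p => s p.1 (p.2 + 1))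
    (hN : PolyBound (fun i => (s i 0).size) N)
    (hb : PolyBound (fun p : Σ i, Fin (N i + 1) => (s p.1 0).size) fun p => (s p.1 p.2).size) :
    PT (fun i => s i 0) fun i => s i (N i) := by
  obtain ⟨c, tc, ⟨pc, hpc⟩, hc⟩ := hc
  obtain ⟨f, tf, ⟨pf, hpf⟩, hf⟩ := hs
  obtain ⟨pb, hpb⟩ := hb
  -- Bound for the cost of one round: the size of the state, the test and the body, each estimated
  -- through `hb` by the size of the initial state.
  set M : ι → ℕ := fun i =>
    pb.eval (s i 0).size + pc.eval (pb.eval (s i 0).size) + pf.eval (pb.eval (s i 0).size) with hM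
  -- `m` counts the rounds still to be done, because `Runs.loopStep` adds a round in front of a run.
  have key : ∀ i m, m ≤ N i → ∃ t ≤ (m + 1) * M i,
      Runs (.loop c f) (s i (N i - m)) (s i (N i)) t := by
    intro i m
    induction m with
    | zero =>
      intro _
      have h := hc ⟨i, Fin.last _⟩
      simp only [Fin.val_last, lt_irrefl, if_false] at h
      refine ⟨_, ?_, Runs.loopStop h⟩
      have h1 := hpc ⟨i, Fin.last _⟩
      have h2 := hpb ⟨i, Fin.last _⟩
      have h3 := eval_le_eval pc h2
      simp only [Fin.val_last] at h1 h2 h3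
      simp only [hM, Nat.sub_zero]
      omega
    | succ m ih =>
      intro hm
      obtain ⟨t, ht, hr⟩ := ih (by omega)
      have hlt : N i - (m + 1) < N i := by omega
      have h := hc ⟨i, ⟨N i - (m + 1), by omega⟩⟩
      simp only [hlt, if_true] at h
      have h' := hf ⟨i, ⟨N i - (m + 1), hlt⟩⟩
      have e : N i - (m + 1) + 1 = N i - m := by omega
      simp only [e] at h'
      refine ⟨_, ?_, Runs.loopStep h h' hr⟩
      have h1 := hpc ⟨i, ⟨N i - (m + 1), by omega⟩⟩
      have h2 := hpb ⟨i, ⟨N i - (m + 1), by omega⟩⟩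
      have h3 := eval_le_eval pc h2
      have h4 := hpf ⟨i, ⟨N i - (m + 1), hlt⟩⟩
      have h5 := eval_le_eval pf h2
      simp only at h1 h2 h3 h4 h5
      have : (m + 1 + 1) * M i = (m + 1) * M i + M i := by ring
      rw [this]
      have h6 : M i = pb.eval (s i 0).size + pc.eval (pb.eval (s i 0).size)
        + pf.eval (pb.eval (s i 0).size) := rfl
      omega
  choose t ht hr using fun i => key i (N i) le_rfl
  simp only [Nat.sub_self] at hr
  refine ⟨_, t, ?_, hr⟩
  refine PolyBound.mono ?_ ht
  have hs0 : PolyBound (fun i => (s i 0).size) fun i => (s i 0).size := .self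
  exact (hN.add (.const 1)).mul (((hs0.eval pb).add ((hs0.eval pb).eval pc)).add
    ((hs0.eval pb).eval pf))

/-- Iteration over a list, with a state of polynomial size. -/
theorem fold {l : ι → List Data} {acc : ι → ℕ → Data}
    (hl : PT a fun i => listData (l i)) (h0 : PT a fun i => acc i 0)
    (hs : PT (fun p : Σ i, Fin (l i).length =>
      .node (a p.1) (.node ((l p.1)[p.2]) (acc p.1 p.2))) fun p => acc p.1 (p.2 + 1))
    (hb : PolyBound (fun p : Σ i, Fin ((l i).length + 1) => (a p.1).size)
      fun p => (acc p.1 p.2).size) :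
    PT a fun i => acc i (l i).length := by
  classical
  -- The state holds the rest of the list, the untouched environment and the accumulator; the loop
  -- stops when the rest is the leaf.
  set s : ι → ℕ → Data := fun i k =>
    .node (listData ((l i).drop k)) (.node (a i) (acc i k)) with hsdef
  have start : PT a fun i => s i 0 := (hl.node (self.node h0)).congr fun i => by simp [s]
  refine start.trans (PT.trans (PT.loop (N := fun i => (l i).length) ?_ ?_ ?_ ?_)
    (self.right.right))
  · have h : PT (fun p : Σ i, Fin ((l i).length + 1) => s p.1 p.2)
      fun p => (s p.1 p.2).left := self.left
    refine (h.ite_nil .nil (nil.node nil)).congr fun p => ?_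
    by_cases hp : (p.2 : ℕ) < (l p.1).length
    · rw [if_pos hp, if_neg]
      simp only [s, Data.left]
      rw [List.drop_eq_getElem_cons hp]
      simp [listData]
    · rw [if_neg hp, if_pos]
      simp only [s, Data.left]
      rw [List.drop_eq_nil_of_le (by omega)]
      rfl
  · have hd : ∀ p : Σ i, Fin (l i).length, listData ((l p.1).drop p.2) =
        .node ((l p.1)[p.2]) (listData ((l p.1).drop (p.2 + 1))) := by
      intro p
      rw [List.drop_eq_getElem_cons p.2.2]
      rfl
    have h : PT (fun p : Σ i, Fin (l i).length => s p.1 p.2)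
        fun p => .node (a p.1) (.node ((l p.1)[p.2]) (acc p.1 p.2)) := by
      refine (self.right.left.node (self.left.left.node self.right.right)).congr fun p => ?_
      simp only [s, hd, Data.left, Data.right]
    refine (self.left.right.node (self.right.left.node (h.trans hs))).congr fun p => ?_
    simp only [s, hd, Data.left, Data.right]
  · refine PolyBound.mono .self fun i => ?_
    have := length_le_size_listData (l i)
    simp only [s, Data.size, List.drop_zero]
    omega
  · obtain ⟨q, hq⟩ := hb
    have h0 : PolyBound (fun p : Σ i, Fin ((l i).length + 1) => (s p.1 0).size)
      fun p => (s p.1 0).size := .self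
    refine ((h0.add h0).add (h0.eval q)).mono fun p => ?_
    have h1 : (acc p.1 p.2).size ≤ q.eval (a p.1).size := hq p
    have h2 := eval_le_eval q (show (a p.1).size ≤ (s p.1 0).size by
      simp only [s, Data.size]; omega)
    have h3 := size_listData_drop_le (l p.1) p.2
    have h4 : (s p.1 0).size = 1 + (listData (l p.1)).size + (1 + (a p.1).size + (acc p.1 0).size) := by
      simp [s, Data.size]
    have h5 := (acc p.1 0).one_le_size
    have h6 : (s p.1 p.2).size = 1 + (listData ((l p.1).drop p.2)).size +
      (1 + (a p.1).size + (acc p.1 p.2).size) := by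
      simp [s, Data.size]
    omega

end PT

/-! ### Programs on lists and unary numbers -/

theorem size_listData_reverse (l : List Data) :
    (listData l.reverse).size = (listData l).size := by
  simp [size_listData]

theorem size_listData_append (l l' : List Data) :
    (listData (l ++ l')).size + 1 = (listData l).size + (listData l').size := by
  simp only [size_listData, List.map_append, List.sum_append]
  omega

theorem size_listData_take_le (l : List Data) (k : ℕ) :
    (listData (l.take k)).size ≤ (listData l).size := by
  have h := size_listData_append (l.take k) (l.drop k)
  rw [List.take_append_drop] at h
  have := (listData (l.drop k)).one_le_size
  omega

namespace PT

variable {ι ι' : Type} {a b c d : ι → Data}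

theorem iterate {N : ι → ℕ} {acc : ι → ℕ → Data} (hN : PT a fun i => unary (N i))
    (h0 : PT a fun i => acc i 0)
    (hs : PT (fun p : Σ i, Fin (N i) => .node (a p.1) (acc p.1 p.2)) fun p => acc p.1 (p.2 + 1))
    (hb : PolyBound (fun p : Σ i, Fin (N i + 1) => (a p.1).size)
      fun p => (acc p.1 p.2).size) :
    PT a fun i => acc i (N i) := by
  have h := fold (a := a) (l := fun i => List.replicate (N i) .nil) (acc := acc)
    (hN.congr fun i => unary_eq_listData _) h0 ?_ ?_
  · exact h.congr fun i => by simp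
  · let e : (Σ i, Fin (List.replicate (N i) Data.nil).length) → Σ i, Fin (N i) :=
      fun p => ⟨p.1, p.2.cast (by simp)⟩
    exact PT.trans (self.left.node self.right.right) (hs.reindex e)
  · let e : (Σ i, Fin ((List.replicate (N i) Data.nil).length + 1)) → Σ i, Fin (N i + 1) :=
      fun p => ⟨p.1, p.2.cast (by simp)⟩
    exact hb.reindex e

theorem reverse {l : ι → List Data} (hl : PT a fun i => listData (l i)) :
    PT a fun i => listData (l i).reverse := by
  have h := fold (a := a) (l := l) (acc := fun i k => listData ((l i).take k).reverse) hl
    nil ?_ ?_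
  · exact h.congr fun i => by simp
  · refine (self.right.left.node self.right.right).congr fun p => ?_
    have : (l p.1).take (p.2 + 1) = (l p.1).take p.2 ++ [(l p.1)[p.2]] := by
      rw [List.take_add_one]; simp
    rw [this, List.reverse_append]
    rfl
  · refine (hl.size_bound.reindex (Sigma.fst (β := fun i => Fin ((l i).length + 1)))).mono
      fun p => ?_
    rw [size_listData_reverse]
    exact size_listData_take_le _ _

/-- The entries of the reversed first list are put in front of the second list one at a time. -/
theorem append {l l' : ι → List Data} (hl : PT a fun i => listData (l i))
    (hl' : PT a fun i => listData (l' i)) : PT a fun i => listData (l i ++ l' i) := by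
  have h := fold (a := a) (l := fun i => (l i).reverse)
    (acc := fun i k => listData (((l i).reverse.take k).reverse ++ l' i)) hl.reverse
    (by simpa using hl') ?_ ?_
  · exact h.congr fun i => by rw [List.take_length, List.reverse_reverse]
  · refine (self.right.left.node self.right.right).congr fun p => ?_
    have : (l p.1).reverse.take (p.2 + 1) =
        (l p.1).reverse.take p.2 ++ [(l p.1).reverse[p.2]] := by
      rw [List.take_add_one, List.getElem?_eq_getElem p.2.2]
      rfl
    rw [this, List.reverse_append]
    rfl
  · refine ((hl.size_bound.add hl'.size_bound).reindex
      (Sigma.fst (β := fun i => Fin ((l i).reverse.length + 1)))).mono fun p => ?_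
    have h1 := size_listData_append ((l p.1).reverse.take p.2).reverse (l' p.1)
    have h2 := size_listData_take_le (l p.1).reverse p.2
    rw [size_listData_reverse] at h1 h2
    show (listData (((l p.1).reverse.take p.2).reverse ++ l' p.1)).size ≤ _
    omega

theorem drop {N : ι → ℕ} {l : ι → List Data} (hN : PT a fun i => unary (N i))
    (hl : PT a fun i => listData (l i)) : PT a fun i => listData ((l i).drop (N i)) := by
  refine iterate (acc := fun i k => listData ((l i).drop k)) hN (by simpa using hl) ?_ ?_
  · refine self.right.right.congr fun p => ?_
    simp only [Data.right]
    rw [← List.tail_drop]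
    cases (l p.1).drop p.2 <;> rfl
  · refine (hl.size_bound.reindex (Sigma.fst (β := fun i => Fin (N i + 1)))).mono
      fun p => size_listData_drop_le _ _

/-- A loop can only add entries at the front, so the prefix is collected backwards next to the
remaining list and reversed at the end. -/
theorem take {N : ι → ℕ} {l : ι → List Data} (hN : PT a fun i => unary (N i))
    (hl : PT a fun i => listData (l i)) : PT a fun i => listData ((l i).take (N i)) := by
  classical
  have h := iterate (acc := fun i k =>
    .node (listData ((l i).take k).reverse) (listData ((l i).drop k))) hN
    (nil.node (by simpa using hl)) ?_ ?_
  · exact h.left.reverse.congr fun i => by simp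
  · have hr := self (a := fun p : Σ i, Fin (N i) => Data.node (a p.1) (Data.node
      (listData ((l p.1).take p.2).reverse) (listData ((l p.1).drop p.2))))
    refine (hr.right.right.ite_nil hr.right
      ((hr.right.right.left.node hr.right.left).node hr.right.right.right)).congr fun p => ?_
    simp only [Data.right, Data.left]
    by_cases hp : (p.2 : ℕ) < (l p.1).length
    · have h1 : (l p.1).take (p.2 + 1) = (l p.1).take p.2 ++ [(l p.1)[(p.2 : ℕ)]] := by
        rw [List.take_add_one]; simp [hp]
      rw [List.drop_eq_getElem_cons hp, h1, List.reverse_append]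
      simp [listData]
    · rw [List.drop_eq_nil_of_le (by omega), List.drop_eq_nil_of_le (by omega),
        List.take_of_length_le (by omega), List.take_of_length_le (by omega)]
      simp [listData]
  · refine (((PolyBound.const 1).add (hl.size_bound.add hl.size_bound)).reindex
      (Sigma.fst (β := fun i => Fin (N i + 1)))).mono fun p => ?_
    have h1 := size_listData_take_le (l p.1) p.2
    have h2 := size_listData_drop_le (l p.1) p.2
    simp only [Data.size, size_listData_reverse]
    omega

/-- A polynomial-time function of an entry and its position is applied to all entries. -/
theorem ofFn {l : ι → List Data} {f : (Σ i, Fin (l i).length) → Data}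
    (hl : PT a fun i => listData (l i))
    (hf : PT (fun p : Σ i, Fin (l i).length =>
      .node (a p.1) (.node ((l p.1)[p.2]) (unary p.2))) f) :
    PT a fun i => listData (List.ofFn fun k => f ⟨i, k⟩) := by
  set L : ι → List Data := fun i => List.ofFn fun k => f ⟨i, k⟩ with hL
  have hlen : ∀ i, (L i).length = (l i).length := fun i => by simp [L]
  have h := fold (a := a) (l := l)
    -- The accumulator pairs the current position with the outputs so far, in reverse order.
    (acc := fun i k => .node (unary k) (listData ((L i).take k).reverse)) hl (nil.node nil) ?_ ?_
  · exact h.right.reverse.congr fun i => by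
      rw [List.reverse_reverse, List.take_of_length_le (hlen i).le]
  · have hr := self (a := fun p : Σ i, Fin (l i).length => Data.node (a p.1) (Data.node
      ((l p.1)[p.2]) (Data.node (unary p.2) (listData ((L p.1).take p.2).reverse))))
    have hv : PT (fun p : Σ i, Fin (l i).length => Data.node (a p.1) (Data.node
      ((l p.1)[p.2]) (Data.node (unary p.2) (listData ((L p.1).take p.2).reverse)))) f :=
      PT.trans (hr.left.node (hr.right.left.node hr.right.right.left)) hf
    refine ((nil.node hr.right.right.left).node
      (hv.node hr.right.right.right)).congr fun p => ?_
    have h1 : (L p.1).take (p.2 + 1) = (L p.1).take p.2 ++ [f p] := by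
      rw [List.take_add_one]; simp [L]
    rw [h1]
    simp [Data.right, Data.left, listData, unary]
  · obtain ⟨q, hq⟩ := hf.size_bound
    obtain ⟨r, hr⟩ := hl.size_bound
    have h0 : PolyBound (fun p : Σ i, Fin ((l i).length + 1) => (a p.1).size)
      fun p => (a p.1).size := .self
    -- `f` is run on a tree consisting of the environment, one entry and a position; the summand 3
    -- in the argument of `q` counts the two inner nodes and the closing leaf of the unary position.
    have hr' := h0.eval r
    refine ((PolyBound.const 1).add ((((PolyBound.const 2).mul hr').add (.const 1)).add
      ((PolyBound.const 1).add (hr'.mul ((PolyBound.const 1).add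
        (((PolyBound.const 3).add ((h0.add hr').add
          ((PolyBound.const 2).mul hr'))).eval q)))))).mono fun p => ?_
    have h1 : (l p.1).length ≤ r.eval (a p.1).size :=
      (length_le_size_listData _).trans (hr p.1)
    simp only [Data.size, size_listData_reverse]
    have h2 : (unary p.2).size ≤ 2 * r.eval (a p.1).size + 1 := by
      rw [size_unary]; have := p.2.2; omega
    have h3 : (listData ((L p.1).take p.2)).size ≤ _ :=
      (size_listData_take_le _ _).trans (size_listData_le (n := r.eval (a p.1).size)
        (M := q.eval (3 + ((a p.1).size + r.eval (a p.1).size + 2 * r.eval (a p.1).size)))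
        ((hlen _).trans_le h1) ?_)
    · exact (Nat.add_assoc _ _ _).trans_le (Nat.add_le_add le_rfl (Nat.add_le_add h2 h3))
    · intro x hx
      obtain ⟨k, rfl⟩ := (List.mem_ofFn' _ _).1 hx
      refine (hq ⟨p.1, k⟩).trans (eval_le_eval q ?_)
      have h5 : ((l p.1)[k]).size ≤ r.eval (a p.1).size :=
        (size_le_size_listData (List.getElem_mem _)).trans (hr p.1)
      simp only [Data.size, size_unary]
      have := k.2
      omega

/-- The subtype asks for `f` to be computable only on actual entries of the list. -/
theorem map {l : ι → List Data} {f : ι → Data → Data} (hl : PT a fun i => listData (l i))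
    (hf : PT (fun p : Σ i, {x // x ∈ l i} => .node (a p.1) p.2) fun p => f p.1 p.2) :
    PT a fun i => listData ((l i).map (f i)) := by
  have h := ofFn (f := fun p => f p.1 ((l p.1)[p.2])) hl ?_
  · refine h.congr fun i => ?_
    congr 1
    apply List.ext_getElem <;> simp
  · let e : (Σ i, Fin (l i).length) → Σ i, {x // x ∈ l i} :=
      fun p => ⟨p.1, (l p.1)[p.2], List.getElem_mem _⟩
    exact PT.trans (self.left.node self.right.left) (hf.reindex e)

theorem mapRange {N : ι → ℕ} {f : ι → ℕ → Data} (hN : PT a fun i => unary (N i))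
    (hf : PT (fun p : Σ i, Fin (N i) => .node (a p.1) (unary p.2)) fun p => f p.1 p.2) :
    PT a fun i => listData ((List.range (N i)).map (f i)) := by
  have h := ofFn (a := a) (l := fun i => List.replicate (N i) .nil) (f := fun p => f p.1 p.2)
    (hN.congr fun i => unary_eq_listData _) ?_
  · refine h.congr fun i => ?_
    congr 1
    apply List.ext_getElem <;> simp
  · let e : (Σ i, Fin (List.replicate (N i) Data.nil).length) → Σ i, Fin (N i) :=
      fun p => ⟨p.1, p.2.cast (by simp)⟩
    exact PT.trans (self.left.node self.right.right) (hf.reindex e)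

/-- The loop runs over the first list while the accumulator consumes the second. -/
theorem zip {l l' : ι → List Data} (hl : PT a fun i => listData (l i))
    (hl' : PT a fun i => listData (l' i)) :
    PT a fun i => listData (List.zipWith .node (l i) (l' i)) := by
  classical
  have h := fold (acc := fun i k =>
    .node (listData ((List.zipWith .node (l i) (l' i)).take k).reverse)
      (listData ((l' i).drop k))) hl (nil.node (by simpa using hl')) ?_ ?_
  · refine h.left.reverse.congr fun i => ?_
    rw [List.reverse_reverse, List.take_of_length_le (by simp)]
  · have hr := self (a := fun p : Σ i, Fin (l i).length => Data.node (a p.1) (Data.node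
      ((l p.1)[p.2]) (Data.node
      (listData ((List.zipWith .node (l p.1) (l' p.1)).take p.2).reverse)
      (listData ((l' p.1).drop p.2)))))
    -- Once the second list is used up the accumulator stays as it is, in agreement with the
    -- truncation by `List.zipWith`.
    refine (hr.right.right.right.ite_nil hr.right.right
      (((hr.right.left.node hr.right.right.right.left).node hr.right.right.left).node
        hr.right.right.right.right)).congr fun p => ?_
    simp only [Data.right, Data.left]
    by_cases hp : (p.2 : ℕ) < (l' p.1).length
    · have h1 : (List.zipWith Data.node (l p.1) (l' p.1)).take (p.2 + 1) =
          (List.zipWith Data.node (l p.1) (l' p.1)).take p.2 ++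
            [.node ((l p.1)[p.2]) ((l' p.1)[(p.2 : ℕ)])] := by
        rw [List.take_add_one]; simp [hp]
      rw [List.drop_eq_getElem_cons hp, h1]
      simp [listData]
    · rw [List.drop_eq_nil_of_le (by omega), List.drop_eq_nil_of_le (by omega),
        List.take_of_length_le (by simp; omega), List.take_of_length_le (by simp; omega)]
      simp [listData]
  · obtain ⟨q, hq⟩ := hl.size_bound
    obtain ⟨r, hr⟩ := hl'.size_bound
    replace hq : ∀ i, (listData (l i)).size ≤ q.eval (a i).size := hq
    replace hr : ∀ i, (listData (l' i)).size ≤ r.eval (a i).size := hr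
    have h0 : PolyBound (fun p : Σ i, Fin ((l i).length + 1) => (a p.1).size)
      fun p => (a p.1).size := .self
    refine ((PolyBound.const 1).add (((PolyBound.const 1).add ((h0.eval q).mul
      ((PolyBound.const 1).add ((PolyBound.const 1).add ((h0.eval q).add (h0.eval r)))))).add
        (h0.eval r))).mono fun p => ?_
    simp only [Data.size, size_listData_reverse]
    refine (Nat.add_assoc _ _ _).trans_le (Nat.add_le_add le_rfl (Nat.add_le_add
      ((size_listData_take_le _ _).trans ?_) ((size_listData_drop_le _ _).trans (hr p.1))))
    refine size_listData_le ?_ ?_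
    · have := (length_le_size_listData (l p.1)).trans (hq p.1)
      simp only [List.length_zipWith]; omega
    · intro x hx
      obtain ⟨k, hk, rfl⟩ := List.mem_iff_getElem.1 hx
      simp only [List.getElem_zipWith, Data.size]
      simp only [List.length_zipWith] at hk
      have h1 := (size_le_size_listData (List.getElem_mem
        (show k < (l p.1).length by omega))).trans (hq p.1)
      have h2 := (size_le_size_listData (List.getElem_mem
        (show k < (l' p.1).length by omega))).trans (hr p.1)
      omega

theorem zipWith {l l' : ι → List Data} {f : ι → Data → Data → Data}
    (hl : PT a fun i => listData (l i)) (hl' : PT a fun i => listData (l' i))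
    (hf : PT (fun p : Σ i, {x // x ∈ l i} × {x // x ∈ l' i} =>
      .node (a p.1) (.node p.2.1 p.2.2)) fun p => f p.1 p.2.1 p.2.2) :
    PT a fun i => listData (List.zipWith (f i) (l i) (l' i)) := by
  have h := map (f := fun i x => f i x.left x.right) (hl.zip hl') ?_
  · refine h.congr fun i => ?_
    rw [List.map_zipWith]
    rfl
  · have hx : ∀ p : Σ i, {x // x ∈ List.zipWith Data.node (l i) (l' i)},
        ∃ y : {x // x ∈ l p.1} × {x // x ∈ l' p.1}, (p.2 : Data) = .node y.1 y.2 := by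
      rintro ⟨i, x, hx⟩
      obtain ⟨k, hk, rfl⟩ := List.mem_iff_getElem.1 hx
      simp only [List.length_zipWith] at hk
      exact ⟨⟨⟨(l i)[k]'(by omega), List.getElem_mem _⟩, ⟨(l' i)[k]'(by omega),
        List.getElem_mem _⟩⟩, by simp⟩
    choose y hy using hx
    let e : (Σ i, {x // x ∈ List.zipWith Data.node (l i) (l' i)}) →
      Σ i, {x // x ∈ l i} × {x // x ∈ l' i} := fun p => ⟨p.1, y p⟩
    have := hf.reindex e
    refine PT.trans (self.congr fun p => ?_) (this.congr fun p => ?_)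
    · rw [hy]
    · simp only [hy, Data.left, Data.right]; rfl

/-! #### Arithmetic in unary notation -/

theorem length {l : ι → List Data} (hl : PT a fun i => listData (l i)) :
    PT a fun i => unary (l i).length :=
  (hl.map (f := fun _ _ => .nil) nil).congr fun i => by
    rw [unary_eq_listData, List.map_const']

theorem add {m n : ι → ℕ} (hm : PT a fun i => unary (m i)) (hn : PT a fun i => unary (n i)) :
    PT a fun i => unary (m i + n i) := by
  simp only [unary_eq_listData] at *
  exact (hm.append hn).congr fun i => by rw [← List.replicate_add]

/-- Truncated subtraction is the dropping of leaves. -/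
theorem sub {m n : ι → ℕ} (hm : PT a fun i => unary (m i)) (hn : PT a fun i => unary (n i)) :
    PT a fun i => unary (m i - n i) := by
  have h : PT a fun i => listData (List.replicate (m i) .nil) :=
    hm.congr fun i => unary_eq_listData _
  exact (hn.drop h).congr fun i => by
    rw [unary_eq_listData, List.drop_replicate]

theorem mul {m n : ι → ℕ} (hm : PT a fun i => unary (m i)) (hn : PT a fun i => unary (n i)) :
    PT a fun i => unary (m i * n i) := by
  refine (iterate (acc := fun i k => unary (k * n i)) hm (nil.congr fun i => by simp [unary])
    ?_ ?_).congr fun i => rfl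
  · refine (self.right.add (hn.fst _ _)).congr fun p => ?_
    ring_nf
  · have h0 := (hm.size_bound.mul hn.size_bound).reindex
      (Sigma.fst (β := fun i => Fin (m i + 1)))
    refine h0.mono fun p => ?_
    simp only [size_unary]
    have : (p.2 : ℕ) * n p.1 ≤ m p.1 * n p.1 := Nat.mul_le_mul_right _ (by omega)
    nlinarith

/-- Lets a program compute the ciphertext bound `B.eval κ` from the security parameter in order to
cap at it. -/
theorem eval (p : Polynomial ℕ) {n : ι → ℕ} (hn : PT a fun i => unary (n i)) :
    PT a fun i => unary (p.eval (n i)) := by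
  induction p using Polynomial.induction_on with
  | C c => exact (const (unary c)).congr fun i => by simp
  | add p q hp hq => exact (hp.add hq).congr fun i => by simp
  | monomial k c h =>
    exact (h.mul hn).congr fun i => by simp [pow_succ, mul_assoc]

end PT

/-! ### Bounding the size of a tree -/

/-- The tree itself if its size is at most `B`, otherwise the leaf. -/
def Data.cap (B : ℕ) (x : Data) : Data := if x.size ≤ B then x else .nil

theorem Data.cap_of_le {B : ℕ} {x : Data} (h : x.size ≤ B) : x.cap B = x := if_pos h

theorem Data.size_cap_le (B : ℕ) (x : Data) : (x.cap B).size ≤ B + 1 := by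
  unfold Data.cap
  split
  · omega
  · simp [Data.size]

/-- One step of a traversal with a stack of trees. -/
def traverse : List Data → List Data
  | [] => []
  | .nil :: st => st
  | .node l r :: st => l :: r :: st

/-- Each step consumes exactly one node: a leaf is popped, or an inner node is replaced by its two
children. The stack is thus empty after `k` steps if and only if its total size was at most `k`. -/
theorem sum_size_traverse (st : List Data) :
    ((traverse st).map Data.size).sum = (st.map Data.size).sum - 1 := by
  rcases st with _ | ⟨_ | ⟨l, r⟩, st⟩
  · rfl
  · simp [traverse, Data.size]
  · simp only [traverse, Data.size, List.map_cons, List.sum_cons]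
    omega

theorem sum_size_traverse_iterate (st : List Data) (k : ℕ) :
    ((traverse^[k] st).map Data.size).sum = (st.map Data.size).sum - k := by
  induction k with
  | zero => rfl
  | succ k ih => rw [Function.iterate_succ_apply', sum_size_traverse, ih]; omega

theorem sum_size_eq_zero {st : List Data} : (st.map Data.size).sum = 0 ↔ st = [] := by
  rcases st with _ | ⟨x, st⟩
  · simp
  · have := x.one_le_size
    simp; omega

/-- Every tree on the stack has size at least one and so pays for its node in the spine; the stack
stays linear in the size of the traversed tree. -/
theorem size_listData_le_sum (st : List Data) :
    (listData st).size ≤ 1 + 2 * (st.map Data.size).sum := by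
  induction st with
  | nil => simp [listData, Data.size]
  | cons x st ih =>
    have := x.one_le_size
    simp only [listData, Data.size, List.map_cons, List.sum_cons]
    omega

/-! ### Typed computations -/

theorem polyTimeOn_iff {α β : Type} [Coded α] [Coded β] {S : Set α} {f : α → β} :
    PolyTimeOn S f ↔ PT (fun x : S => code x.1) fun x => code (f x.1) := by
  constructor
  · rintro ⟨P, p, h⟩
    choose t ht hr using h
    exact ⟨P, fun x => t x.1 x.2, ⟨p, fun x => ht x.1 x.2⟩, fun x => hr x.1 x.2⟩
  · rintro ⟨P, t, ⟨p, ht⟩, hr⟩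
    exact ⟨P, p, fun x hx => ⟨t ⟨x, hx⟩, ht ⟨x, hx⟩, hr ⟨x, hx⟩⟩⟩

theorem polyTime_iff {α β : Type} [Coded α] [Coded β] {f : α → β} :
    PolyTime f ↔ PT (fun x : α => code x) fun x => code (f x) := by
  rw [PolyTime, polyTimeOn_iff]
  exact ⟨fun h => h.reindex fun x => ⟨x, trivial⟩, fun h => h.reindex Subtype.val⟩

theorem PolyTimeOn.pt {ι α β : Type} [Coded α] [Coded β] {S : Set α} {f : α → β}
    (h : PolyTimeOn S f) {a : ι → Data} {g : ι → α} (hS : ∀ i, g i ∈ S)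
    (hg : PT a fun i => code (g i)) : PT a fun i => code (f (g i)) :=
  hg.trans ((polyTimeOn_iff.1 h).reindex fun i => ⟨g i, hS i⟩)

theorem PolyTime.pt {ι α β : Type} [Coded α] [Coded β] {f : α → β} (h : PolyTime f)
    {a : ι → Data} (g : ι → α) (hg : PT a fun i => code (g i)) :
    PT a fun i => code (f (g i)) :=
  PolyTimeOn.pt h (fun _ => trivial) hg

/-- Replaces a domain described by an existential statement by an index type, such as the type of
honest executions, so that the data of the execution can be used in the proof. -/
theorem polyTimeOn_of_pt {ι α β : Type} [Coded α] [Coded β] {S : Set α} {f : α → β}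
    {g : ι → α} (hS : ∀ x ∈ S, ∃ i, x = g i)
    (h : PT (fun i => code (g i)) fun i => code (f (g i))) : PolyTimeOn S f := by
  choose e he using hS
  have hg : ∀ x : S, g (e x.1 x.2) = x.1 := fun x => (he x.1 x.2).symm
  have h' := h.reindex fun x : S => e x.1 x.2
  simp only [hg] at h'
  exact polyTimeOn_iff.2 h'

/-- The entries of a tree read as bits. -/
def Data.toBits (d : Data) : List Bool :=
  d.toList.map fun
    | .nil => false
    | .node _ _ => true

theorem code_bits (r : List Bool) : (code r : Data) = listData (r.map code) := rfl

@[simp] theorem toBits_code (r : List Bool) : (code r : Data).toBits = r := by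
  rw [code_bits, Data.toBits, toList_listData, List.map_map]
  conv_rhs => rw [← List.map_id r]
  refine List.map_congr_left fun b _ => ?_
  cases b <;> rfl

theorem size_code_bits_le (r : List Bool) : (code r : Data).size ≤ 1 + r.length * 4 := by
  rw [code_bits]
  refine size_listData_le (M := 3) (List.length_map _).le ?_
  intro x hx
  obtain ⟨b, _, rfl⟩ := List.mem_map.1 hx
  cases b <;> simp [code, Data.size]

@[simp] theorem code_listData (l : List Data) : (code l : Data) = listData l := by
  show listData (l.map fun x => x) = _
  rw [List.map_id']

namespace PT

variable {ι ι' : Type} {a b c d : ι → Data}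

/-- Traverses the tree for `B i` steps and tests whether the stack is empty. -/
theorem cap {B : ι → ℕ} (hB : PT a fun i => unary (B i)) (hb : PT a b) :
    PT a fun i => (b i).cap (B i) := by
  classical
  have h := iterate (acc := fun i k => listData (traverse^[k] [b i])) hB (hb.node nil) ?_ ?_
  · refine (h.ite_nil hb nil).congr fun i => ?_
    have h1 := sum_size_traverse_iterate [b i] (B i)
    have h2 := sum_size_eq_zero (st := traverse^[B i] [b i])
    have h3 : listData (traverse^[B i] [b i]) = .nil ↔ traverse^[B i] [b i] = [] := by
      cases traverse^[B i] [b i] <;> simp [listData]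
    simp only [h3, ← h2, h1, Data.cap]
    simp [Nat.sub_eq_zero_iff_le]
  · have hr : PT (fun p : Σ i, Fin (B i) =>
      Data.node (a p.1) (listData (traverse^[p.2] [b p.1]))) _ := self.right
    refine (hr.ite_nil nil (hr.left.ite_nil hr.right
      (hr.left.left.node (hr.left.right.node hr.right)))).congr fun p => ?_
    rw [Function.iterate_succ_apply']
    simp only [Data.right]
    rcases traverse^[p.2] [b p.1] with _ | ⟨_ | ⟨l, r⟩, st⟩ <;>
      simp [traverse, listData, Data.left]
  · refine (((PolyBound.const 1).add ((PolyBound.const 2).mul hb.size_bound)).reindex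
      (Sigma.fst (β := fun i => Fin (B i + 1)))).mono fun p => ?_
    refine (size_listData_le_sum _).trans ?_
    rw [sum_size_traverse_iterate]
    simp only [List.map_cons, List.map_nil, List.sum_cons, List.sum_nil]
    omega

theorem toBits (hb : PT a b) : PT a fun i => code (b i).toBits := by
  classical
  have h : PT a fun i => listData (b i).toList := hb.congr fun i => by simp
  have hr : PT (fun p : Σ i, {x // x ∈ (b i).toList} => Data.node (a p.1) p.2) _ := self.right
  refine (h.map (f := fun _ x => if x = .nil then .nil else .node .nil .nil)
    (hr.ite_nil nil (nil.node nil))).congr fun i => ?_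
  rw [code_bits, Data.toBits, List.map_map]
  congr 1
  refine List.map_congr_left fun x _ => ?_
  cases x <;> simp [code]

theorem take_bits {N : ι → ℕ} {r : ι → List Bool} (hN : PT a fun i => unary (N i))
    (hr : PT a fun i => code (r i)) : PT a fun i => code ((r i).take (N i)) :=
  (hN.take hr).congr fun i => by rw [code_bits, List.map_take]

theorem drop_bits {N : ι → ℕ} {r : ι → List Bool} (hN : PT a fun i => unary (N i))
    (hr : PT a fun i => code (r i)) : PT a fun i => code ((r i).drop (N i)) :=
  (hN.drop hr).congr fun i => by rw [code_bits, List.map_drop]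

/-- Two numbers are equal when both truncated differences vanish. -/
theorem decide_eq {m n : ι → ℕ} (hm : PT a fun i => unary (m i))
    (hn : PT a fun i => unary (n i)) : PT a fun i => code (decide (m i = n i)) := by
  classical
  refine ((hm.sub hn).ite_nil ((hn.sub hm).ite_nil (nil.node nil) nil) nil).congr fun i => ?_
  have h : ∀ k, unary k = .nil ↔ k = 0 := fun k => by cases k <;> simp [unary]
  simp only [h, code]
  by_cases e : m i = n i
  · simp [e]
  · have : m i - n i ≠ 0 ∨ n i - m i ≠ 0 := by omega
    rcases this with h | h <;> simp [h, e]

/-! #### Encryption -/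

variable (A : AHE) {κ n s : ι → ℕ} {pk : ι → Data} {r : ι → List Bool}

theorem bit {e : ι → Bool} (hκ : PT a fun i => unary (κ i)) (hpk : PT a pk)
    (he : PT a fun i => code (e i)) : PT a fun i => A.bit (κ i) (pk i) (e i) := by
  refine (A.bit_polyTime.pt (fun i => (κ i, pk i, e i)) (hκ.node (hpk.node he))).congr
    fun i => ?_
  cases e i
  · simp [AHE.bit]; rfl
  · simp [AHE.bit]; rfl

theorem encBit {e : ι → Bool} (hκ : PT a fun i => unary (κ i)) (hpk : PT a pk)
    (he : PT a fun i => code (e i)) (hr : PT a fun i => code (r i)) :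
    PT a fun i => A.enc (κ i) (pk i) (A.bit (κ i) (pk i) (e i)) (r i) :=
  A.enc_polyTime.pt (fun i => (κ i, pk i, A.bit (κ i) (pk i) (e i), r i))
    (hκ.node (hpk.node ((hκ.bit A hpk he).node hr)))

theorem encCoins (hκ : PT a fun i => unary (κ i)) : PT a fun i => unary (A.encCoins (κ i)) :=
  A.encCoins_polyTime.pt κ hκ

theorem kgenCoins (hκ : PT a fun i => unary (κ i)) : PT a fun i => unary (A.kgenCoins (κ i)) :=
  A.kgenCoins_polyTime.pt κ hκ

theorem kgen (hκ : PT a fun i => unary (κ i)) (hr : PT a fun i => code (r i)) :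
    PT a fun i => .node (A.kgen (κ i) (r i)).1 (A.kgen (κ i) (r i)).2 :=
  A.kgen_polyTime.pt (fun i => (κ i, r i)) (hκ.node hr)

theorem encVector {e : ι → ℕ → Bool} (hκ : PT a fun i => unary (κ i)) (hpk : PT a pk)
    (hn : PT a fun i => unary (n i)) (hr : PT a fun i => code (r i))
    (he : PT (fun p : Σ i, Fin (n i) => .node (a p.1) (unary p.2))
      fun p => code (e p.1 p.2)) :
    PT a fun i => listData ((List.range (n i)).map fun k =>
      A.enc (κ i) (pk i) (A.bit (κ i) (pk i) (e i k))
        (((r i).drop (k * A.encCoins (κ i))).take (A.encCoins (κ i)))) := by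
  refine hn.mapRange ?_
  have hκ' := hκ.fst (fun p : Σ i, Fin (n i) => p.1) fun p => unary p.2
  have hc := hκ'.encCoins A
  exact hκ'.encBit A (hpk.fst _ _) he
    (hc.take_bits ((self.right.mul hc).drop_bits (hr.fst _ _)))

theorem encOneHot (hκ : PT a fun i => unary (κ i)) (hpk : PT a pk)
    (hn : PT a fun i => unary (n i)) (hs : PT a fun i => unary (s i))
    (hr : PT a fun i => code (r i)) :
    PT a fun i => listData (encOneHot A (κ i) (pk i) (n i) (s i) (r i)) :=
  hκ.encVector A (e := fun i k => decide (k = s i)) hpk hn hr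
    (PT.decide_eq (a := fun p : Σ i, Fin (n i) => .node (a p.1) (unary p.2)) self.right
      (hs.fst _ _))

end PT

/-! ### Homomorphic inner products with ciphertexts of bounded size -/

/-- `compress` with all intermediate ciphertexts capped at size `B`. The rows of the response are
given as trees. -/
def cappedCompress (A : AHE) (B κ : ℕ) (pk : Data) (b res : List Data) : List Data :=
  let rows := List.zipWith
    (fun c e => e.toList.map fun x => (A.hmul κ pk c x).cap B) b res
  rows.tail.foldl (List.zipWith fun x y => (A.hadd κ pk x y).cap B) (rows.headD [])

/-- Size control for the accumulator in `PT.cappedCompress`: `List.zipWith` never lengthens it, and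
every new entry is an output of `f`. -/
theorem foldl_zipWith_spec {f : Data → Data → Data} {M m : ℕ} (hf : ∀ x y, (f x y).size ≤ M)
    (rows : List (List Data)) (v : List Data) (hv : ∀ x ∈ v, x.size ≤ M) (hm : v.length ≤ m) :
    (rows.foldl (List.zipWith f) v).length ≤ m ∧
      ∀ x ∈ rows.foldl (List.zipWith f) v, x.size ≤ M := by
  induction rows generalizing v with
  | nil => exact ⟨hm, hv⟩
  | cons row rows ih =>
    refine ih _ ?_ ?_
    · intro x hx
      obtain ⟨k, hk, rfl⟩ := List.mem_iff_getElem.1 hx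
      simpa using hf _ _
    · simp; omega

/-- No honesty is assumed of `b`, `res` or `pk`. The caps keep each entry of the running sum at size
at most `B i + 1`, which supplies the size bound required by `fold`. -/
theorem PT.cappedCompress {ι : Type} {a pk : ι → Data} {B κ : ι → ℕ} {b res : ι → List Data}
    (A : AHE) (hB : PT a fun i => unary (B i)) (hκ : PT a fun i => unary (κ i)) (hpk : PT a pk)
    (hb : PT a fun i => listData (b i)) (hres : PT a fun i => listData (res i)) :
    PT a fun i => listData (cappedCompress A (B i) (κ i) (pk i) (b i) (res i)) := by
  set rows : ι → List (List Data) := fun i => List.zipWith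
    (fun c e => e.toList.map fun x => (A.hmul (κ i) (pk i) c x).cap (B i)) (b i) (res i)
    with hrows
  have hcap : ∀ i, ∀ v ∈ rows i, ∀ x ∈ v, x.size ≤ B i + 1 := by
    intro i v hv x hx
    obtain ⟨k, hk, rfl⟩ := List.mem_iff_getElem.1 hv
    simp only [rows, List.getElem_zipWith, List.mem_map] at hx
    obtain ⟨y, _, rfl⟩ := hx
    exact Data.size_cap_le _ _
  -- All products are computed before any addition; head and tail of this list are the start of the
  -- sum and the list to iterate over.
  have h1 : PT a fun i => listData ((rows i).map listData) := by
    refine (hb.zipWith (f := fun i c e => listData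
      (e.toList.map fun x => (A.hmul (κ i) (pk i) c x).cap (B i))) hres ?_).congr fun i => ?_
    · let env : (Σ i, {x // x ∈ b i} × {x // x ∈ res i}) → Data :=
        fun p => .node (a p.1) (.node p.2.1 p.2.2)
      have he : PT env fun p => listData (p.2.2 : Data).toList :=
        self.right.right.congr fun p => by simp [env, Data.right]
      have hc : PT env fun p => (p.2.1 : Data) := self.right.left
      refine he.map (f := fun p x => (A.hmul (κ p.1) (pk p.1) p.2.1 x).cap (B p.1)) ?_
      have hB' : PT env fun p => unary (B p.1) := hB.fst _ _
      have hκ' : PT env fun p => unary (κ p.1) := hκ.fst _ _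
      have hpk' : PT env fun p => pk p.1 := hpk.fst _ _
      refine cap (hB'.fst _ _) ?_
      exact A.hmul_polyTime.pt (fun q : Σ p : (Σ i, {x // x ∈ b i} × {x // x ∈ res i}),
          {x // x ∈ (p.2.2 : Data).toList} => (κ q.1.1, pk q.1.1, (q.1.2.1 : Data), (q.2 : Data)))
        ((hκ'.fst _ _).node ((hpk'.fst _ _).node ((hc.fst _ _).node self.right)))
    · rw [List.map_zipWith]
  have h2 : PT a fun i => listData ((rows i).tail.map listData) :=
    h1.right.congr fun i => by cases rows i <;> rfl
  have h3 : PT a fun i => listData ((rows i).headD []) :=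
    h1.left.congr fun i => by cases rows i <;> rfl
  have h4 := fold (acc := fun i k => listData (((rows i).tail.take k).foldl
    (List.zipWith fun x y => (A.hadd (κ i) (pk i) x y).cap (B i)) ((rows i).headD []))) h2 h3
    ?_ ?_
  · refine h4.congr fun i => ?_
    rw [List.length_map, List.take_length]
    rfl
  · set acc : ι → ℕ → List Data := fun i k => ((rows i).tail.take k).foldl
      (List.zipWith fun x y => (A.hadd (κ i) (pk i) x y).cap (B i)) ((rows i).headD []) with hacc
    let env : (Σ i, Fin ((rows i).tail.map listData).length) → Data := fun p =>
      .node (a p.1) (.node (((rows p.1).tail.map listData)[p.2]) (listData (acc p.1 p.2)))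
    have hx : PT env fun p => listData (acc p.1 p.2) := self.right.right
    have hy : PT env fun p => listData ((rows p.1).tail[(p.2 : ℕ)]'(by simpa using p.2.2)) :=
      self.right.left.congr fun p => by simp [env, Data.left, Data.right]
    refine (hx.zipWith (f := fun p x y => (A.hadd (κ p.1) (pk p.1) x y).cap (B p.1)) hy
      ?_).congr fun p => ?_
    · have hB' : PT env fun p => unary (B p.1) := hB.fst _ _
      have hκ' : PT env fun p => unary (κ p.1) := hκ.fst _ _
      have hpk' : PT env fun p => pk p.1 := hpk.fst _ _
      refine cap (hB'.fst _ _) ?_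
      exact A.hadd_polyTime.pt
        (fun q : Σ p : (Σ i, Fin ((rows i).tail.map listData).length),
          {x // x ∈ acc p.1 p.2} ×
            {x // x ∈ (rows p.1).tail[(p.2 : ℕ)]'(by simpa using p.2.2)} =>
          (κ q.1.1, pk q.1.1, (q.2.1 : Data), (q.2.2 : Data)))
        ((hκ'.fst _ _).node ((hpk'.fst _ _).node self.right))
    · have hlt : (p.2 : ℕ) < (rows p.1).tail.length := by simpa using p.2.2
      have : (rows p.1).tail.take (p.2 + 1) =
          (rows p.1).tail.take p.2 ++ [(rows p.1).tail[(p.2 : ℕ)]] := by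
        rw [List.take_add_one, List.getElem?_eq_getElem hlt]; rfl
      rw [this, List.foldl_append]
      rfl
  · obtain ⟨q, hq⟩ := h3.size_bound
    obtain ⟨r, hr⟩ := hB.size_bound
    replace hq : ∀ i, (listData ((rows i).headD [])).size ≤ q.eval (a i).size := hq
    replace hr : ∀ i, (unary (B i)).size ≤ r.eval (a i).size := hr
    have h0 : PolyBound (fun p : Σ i, Fin (((rows i).tail.map listData).length + 1) =>
      (a p.1).size) fun p => (a p.1).size := .self
    refine ((PolyBound.const 1).add ((h0.eval q).mul ((PolyBound.const 1).add
      ((h0.eval r).add (.const 1))))).mono fun p => ?_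
    have hB' : B p.1 + 1 ≤ r.eval (a p.1).size + 1 := by
      have := hr p.1
      rw [size_unary] at this
      omega
    have h5 := foldl_zipWith_spec
      (f := fun x y => (A.hadd (κ p.1) (pk p.1) x y).cap (B p.1))
      (M := B p.1 + 1) (m := q.eval (a p.1).size) (fun x y => Data.size_cap_le _ _)
      ((rows p.1).tail.take p.2) ((rows p.1).headD []) ?_
      ((length_le_size_listData _).trans (hq p.1))
    · exact size_listData_le h5.1 fun x hx => (h5.2 x hx).trans hB'
    · intro x hx
      cases hrow : rows p.1 with
      | nil => simp [hrow] at hx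
      | cons v vs =>
        rw [hrow] at hx
        exact hcap p.1 v (by simp [hrow]) x hx

open scoped ENNReal

/-! ### Coins -/

theorem bits_apply (ℓ : ℕ) (l : List Bool) :
    bits ℓ l = if l.length = ℓ then ((2 : ℝ≥0∞) ^ ℓ)⁻¹ else 0 := by
  rw [bits, PMF.map_apply]
  split
  · next h =>
    subst h
    rw [tsum_eq_single l.get]
    · simp [List.ofFn_get]
    · intro f hf
      rw [if_neg]
      intro e
      apply hf
      apply List.ofFn_injective
      rw [← e, List.ofFn_get]
  · next h =>
    simp only [ENNReal.tsum_eq_zero, ite_eq_right_iff]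
    rintro f rfl
    simp at h

theorem mem_support_bits {ℓ : ℕ} {l : List Bool} : l ∈ (bits ℓ).support ↔ l.length = ℓ := by
  rw [PMF.mem_support_iff, bits_apply]
  simp

/-- A string arises from only one pair, its first `a` bits and the rest, so each double sum has a
single nonzero term. -/
theorem bits_add (a b : ℕ) :
    bits (a + b) = (bits a).bind fun r => (bits b).map fun r' => r ++ r' := by
  ext l
  rw [PMF.bind_apply, tsum_eq_single (l.take a)]
  · rw [PMF.map_apply, tsum_eq_single (l.drop a)]
    · simp only [bits_apply, List.take_append_drop, if_true, List.length_take, List.length_drop]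
      by_cases h : l.length = a + b
      · rw [if_pos h, if_pos (by omega), if_pos (by omega), pow_add, ENNReal.mul_inv]
        · left; simp
        · left; simp
      · rw [if_neg h]
        by_cases h1 : min a l.length = a
        · rw [if_neg (show ¬ l.length - a = b by omega), mul_zero]
        · rw [if_neg h1, zero_mul]
    · intro r' hr'
      rw [if_neg]
      intro e
      apply hr'
      have h2 : l.take a ++ l.drop a = l.take a ++ r' := by rw [List.take_append_drop]; exact e
      exact (List.append_cancel_left h2).symm
  · intro r hr
    rw [bits_apply]
    split
    · next h =>
      subst h
      rw [PMF.map_apply]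
      convert mul_zero _
      simp only [ENNReal.tsum_eq_zero, ite_eq_right_iff]
      rintro r' rfl
      simp at hr
    · exact zero_mul _

theorem bind_congr_support {α β : Type} {p : PMF α} {f g : α → PMF β}
    (h : ∀ a ∈ p.support, f a = g a) : p.bind f = p.bind g := by
  ext b
  rw [PMF.bind_apply, PMF.bind_apply]
  refine tsum_congr fun a => ?_
  by_cases ha : p a = 0
  · simp [ha]
  · rw [h a ((PMF.mem_support_iff _ _).2 ha)]

theorem bind_bits_add {β : Type} (a b : ℕ) (f : List Bool → PMF β) :
    (bits (a + b)).bind f = (bits a).bind fun r => (bits b).bind fun r' => f (r ++ r') := by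
  rw [bits_add, PMF.bind_bind]
  congr 1
  funext r
  rw [PMF.bind_map]
  rfl

/-! ### Indistinguishability -/

theorem acceptProb_bind {α : Type} (D : ℕ × Data × Data → Bool) (κ : ℕ) (z : Data) (p : PMF α)
    (f : α → PMF Data) :
    acceptProb D κ z (p.bind f) = ∑' a, (p a).toReal * acceptProb D κ z (f a) := by
  rw [acceptProb, PMF.map_bind, PMF.bind_apply, ENNReal.tsum_toReal_eq]
  · simp only [ENNReal.toReal_mul]
    rfl
  · intro a
    exact ENNReal.mul_ne_top (PMF.apply_ne_top _ _) (PMF.apply_ne_top _ _)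

theorem acceptProb_map (D : ℕ × Data × Data → Bool) (κ : ℕ) (z : Data) (p : PMF Data)
    (f : Data → Data) : acceptProb D κ z (p.map f) = ((p.map fun x => D (κ, z, f x)) true).toReal := by
  rw [acceptProb, PMF.map_comp]
  rfl

theorem acceptProb_nonneg (D : ℕ × Data × Data → Bool) (κ : ℕ) (z : Data) (X : PMF Data) :
    0 ≤ acceptProb D κ z X := ENNReal.toReal_nonneg

theorem acceptProb_le_one (D : ℕ × Data × Data → Bool) (κ : ℕ) (z : Data) (X : PMF Data) :
    acceptProb D κ z X ≤ 1 :=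
  (ENNReal.toReal_mono ENNReal.one_ne_top (PMF.coe_le_one _ _)).trans_eq ENNReal.toReal_one

/-- Averaging: a bound for each fixed value of the common randomness carries over to the mixture.
Non-uniformity enters here, since the fixed value may then be given as advice. -/
theorem abs_acceptProb_bind_sub_le {α : Type} {D : ℕ × Data × Data → Bool} {κ : ℕ} {z : Data}
    {p : PMF α} {f g : α → PMF Data} {ε : ℝ}
    (h : ∀ a ∈ p.support, |acceptProb D κ z (f a) - acceptProb D κ z (g a)| ≤ ε) :
    |acceptProb D κ z (p.bind f) - acceptProb D κ z (p.bind g)| ≤ ε := by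
  have hp : HasSum (fun a => (p a).toReal) 1 := by
    have h1 : ∑' a, p a ≠ ∞ := p.tsum_coe_ne_top
    have h2 := (ENNReal.summable_toReal h1).hasSum
    rwa [← ENNReal.tsum_toReal_eq (fun a => PMF.apply_ne_top p a), p.tsum_coe,
      ENNReal.toReal_one] at h2
  have hs : ∀ f : α → PMF Data, Summable fun a => (p a).toReal * acceptProb D κ z (f a) :=
    fun f => Summable.of_nonneg_of_le
      (fun a => mul_nonneg ENNReal.toReal_nonneg (acceptProb_nonneg _ _ _ _))
      (fun a => mul_le_of_le_one_right ENNReal.toReal_nonneg (acceptProb_le_one _ _ _ _))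
      hp.summable
  rw [acceptProb_bind, acceptProb_bind, ← (hs f).tsum_sub (hs g)]
  have hle : ∀ a, |(p a).toReal * acceptProb D κ z (f a) - (p a).toReal * acceptProb D κ z (g a)|
      ≤ (p a).toReal * ε := by
    intro a
    rw [← mul_sub, abs_mul, abs_of_nonneg ENNReal.toReal_nonneg]
    by_cases ha : p a = 0
    · simp [ha]
    · exact mul_le_mul_of_nonneg_left (h a ((PMF.mem_support_iff _ _).2 ha))
        ENNReal.toReal_nonneg
  have hε := hp.mul_right ε
  rw [one_mul] at hε
  have := tsum_of_norm_bounded hε (fun a => (Real.norm_eq_abs _).trans_le (hle a))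
  rwa [Real.norm_eq_abs] at this

theorem Negligible.add {μ ν : ℕ → ℝ} (hμ : Negligible μ) (hν : Negligible ν) :
    Negligible fun κ => μ κ + ν κ := Asymptotics.SuperpolynomialDecay.add hμ hν

theorem Negligible.abs {μ : ℕ → ℝ} (hμ : Negligible μ) : Negligible fun κ => |μ κ| :=
  Asymptotics.SuperpolynomialDecay.trans_abs_le hμ fun κ => (abs_abs (μ κ)).le

namespace CompIndist

variable {ι : Type} {I : ℕ → Set ι} {X Y Z : ℕ → ι → PMF Data}

theorem trans (h : CompIndist I X Y) (h' : CompIndist I Y Z) : CompIndist I X Z := by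
  intro D hD p
  obtain ⟨μ, hμ, h⟩ := h D hD p
  obtain ⟨ν, hν, h'⟩ := h' D hD p
  exact ⟨_, hμ.add hν, fun κ i hi z hz =>
    (abs_sub_le _ _ _).trans (add_le_add (h κ i hi z hz) (h' κ i hi z hz))⟩

theorem congr {X' Y' : ℕ → ι → PMF Data} (h : CompIndist I X Y)
    (hX : ∀ κ, ∀ i ∈ I κ, X κ i = X' κ i) (hY : ∀ κ, ∀ i ∈ I κ, Y κ i = Y' κ i) :
    CompIndist I X' Y' := by
  intro D hD p
  obtain ⟨μ, hμ, h⟩ := h D hD p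
  refine ⟨μ, hμ, fun κ i hi z hz => ?_⟩
  rw [← hX κ i hi, ← hY κ i hi]
  exact h κ i hi z hz

/-- Indistinguishability is preserved by polynomial-time post-processing with independent
random data of polynomial size, which need not be efficiently samplable. -/
theorem bind_map (h : CompIndist I X Y) {T : ℕ → Data → Data → Data}
    (hT : PolyTime fun x : ℕ × Data × Data => T x.1 x.2.1 x.2.2) {R : ℕ → ι → PMF Data}
    {q : Polynomial ℕ} (hR : ∀ κ, ∀ i ∈ I κ, ∀ v ∈ (R κ i).support, v.size ≤ q.eval κ) :
    CompIndist I (fun κ i => (R κ i).bind fun v => (X κ i).map (T κ v))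
      fun κ i => (R κ i).bind fun v => (Y κ i).map (T κ v) := by
  intro D hD p
  have hin : PT (fun x : ℕ × Data × Data => code x) _ := .self
  -- The new distinguisher reads its advice as a pair of the old advice and the fixed random value;
  -- `1 + p + q` bounds the size of that pair.
  obtain ⟨μ, hμ, h⟩ := h (fun x => D (x.1, x.2.1.left, T x.1 x.2.1.right x.2.2))
    (polyTime_iff.2 (hD.pt (fun x : ℕ × Data × Data =>
      (x.1, x.2.1.left, T x.1 x.2.1.right x.2.2)) (hin.left.node (hin.right.left.left.node
        (hT.pt (fun x : ℕ × Data × Data => (x.1, x.2.1.right, x.2.2))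
          (hin.left.node (hin.right.left.right.node hin.right.right)))))))
    (1 + p + q)
  refine ⟨μ, hμ, fun κ i hi z hz => abs_acceptProb_bind_sub_le fun v hv => ?_⟩
  have := h κ i hi (.node z v) (by
    have := hR κ i hi v hv
    simp only [Data.size, Polynomial.eval_add, Polynomial.eval_one]
    omega)
  rw [acceptProb_map, acceptProb_map]
  exact this

end CompIndist

/-! ### IND-CPA security as indistinguishability within a context -/

theorem toReal_apply_not (X : PMF Bool) : (X false).toReal = 1 - (X true).toReal := by
  have h := X.tsum_coe
  rw [tsum_bool] at h
  have := congrArg ENNReal.toReal h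
  rw [ENNReal.toReal_add (PMF.apply_ne_top _ _) (PMF.apply_ne_top _ _),
    ENNReal.toReal_one] at this
  linarith

/-- The winning probability of an adversary that challenges with the zero and the unit. -/
theorem AHE.cpaExperiment_bit (A : AHE) (A₂ : ℕ × Data × Data × Data → Bool) (κ : ℕ) (z : Data) :
    (A.cpaExperiment (fun x => (A.bit x.1 x.2.2 false, A.bit x.1 x.2.2 true, x.2.2)) A₂ κ z
        true).toReal =
      1 / 2 + (((((bits (A.kgenCoins κ)).bind fun r => (bits (A.encCoins κ)).map fun r' =>
          A₂ (κ, z, (A.kgen κ r).2,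
            A.enc κ (A.kgen κ r).2 (A.bit κ (A.kgen κ r).2 true) r')) true).toReal
        - (((bits (A.kgenCoins κ)).bind fun r => (bits (A.encCoins κ)).map fun r' =>
          A₂ (κ, z, (A.kgen κ r).2,
            A.enc κ (A.kgen κ r).2 (A.bit κ (A.kgen κ r).2 false) r')) true).toReal) / 2) := by
  set Y : Bool → PMF Bool := fun b =>
    (bits (A.kgenCoins κ)).bind fun r => (bits (A.encCoins κ)).map fun r' =>
      A₂ (κ, z, (A.kgen κ r).2, A.enc κ (A.kgen κ r).2 (A.bit κ (A.kgen κ r).2 b) r') with hY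
  have hbit : ∀ pk b, A.bit κ pk b ∈ A.Plain κ pk := by
    intro pk b
    unfold AHE.bit
    split <;> exact Subtype.prop _
  -- The two challenges are always admissible, so the adversary wins exactly when its guess is `b`;
  -- the bit can be drawn first because it is independent of the key.
  have h : A.cpaExperiment (fun x => (A.bit x.1 x.2.2 false, A.bit x.1 x.2.2 true, x.2.2)) A₂ κ z
      = (PMF.uniformOfFintype Bool).bind fun b => (Y b).map (· == b) := by
    simp only [hY, PMF.map_bind, PMF.map_comp]
    rw [PMF.bind_comm]
    unfold AHE.cpaExperiment
    congr 1
    funext r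
    refine congrArg (PMF.bind (PMF.uniformOfFintype Bool)) (funext fun b => ?_)
    refine congrArg (PMF.bind (bits (A.encCoins κ))) (funext fun r' => ?_)
    cases b <;> simp [hbit] <;> rfl
  have hb : ∀ b, ((Y b).map (· == b)) true = Y b b := by
    intro b
    rw [PMF.map_apply, tsum_bool]
    cases b <;> simp
  rw [h, PMF.bind_apply, tsum_bool, hb, hb, ENNReal.toReal_add, ENNReal.toReal_mul,
    ENNReal.toReal_mul, toReal_apply_not (Y false)]
  · change _ = 1 / 2 + ((Y true true).toReal - (Y false true).toReal) / 2
    simp only [PMF.uniformOfFintype_apply, Fintype.card_bool, ENNReal.toReal_inv]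
    norm_num
    ring
  · exact ENNReal.mul_ne_top (PMF.apply_ne_top _ _) (PMF.apply_ne_top _ _)
  · exact ENNReal.mul_ne_top (PMF.apply_ne_top _ _) (PMF.apply_ne_top _ _)

/-- Encryptions of zero and one under a fresh key are indistinguishable within any context that
can be computed in polynomial time from independent random data of polynomial size. -/
theorem AHE.INDCPA.compIndist {A : AHE} (h : A.INDCPA) {ι : Type} {I : ℕ → Set ι}
    {T : ℕ → Data → Data → Data → Data}
    (hT : PolyTime fun x : ℕ × Data × Data × Data => T x.1 x.2.1 x.2.2.1 x.2.2.2)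
    {R : ℕ → ι → PMF Data} {q : Polynomial ℕ}
    (hR : ∀ κ, ∀ i ∈ I κ, ∀ v ∈ (R κ i).support, v.size ≤ q.eval κ) {X : Bool → ℕ → ι → PMF Data}
    (hX : ∀ b κ i, X b κ i = (R κ i).bind fun v => (bits (A.kgenCoins κ)).bind fun r =>
      (bits (A.encCoins κ)).map fun r' => T κ v (A.kgen κ r).2
        (A.enc κ (A.kgen κ r).2 (A.bit κ (A.kgen κ r).2 b) r')) :
    CompIndist I (X false) (X true) := by
  intro D hD p
  have hin : PT (fun x : ℕ × Data × Data => code x) _ := .self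
  have hA₁ : PolyTime fun x : ℕ × Data × Data =>
      (A.bit x.1 x.2.2 false, A.bit x.1 x.2.2 true, x.2.2) :=
    polyTime_iff.2 ((hin.left.bit A (e := fun _ => false) hin.right.right (.const _)).node
      ((hin.left.bit A (e := fun _ => true) hin.right.right (.const _)).node hin.right.right))
  -- IND-CPA bounds the winning probability only from above. One adversary repeats the answer of `D`
  -- and the other negates it, which bounds the difference on both sides.
  let A₂ : Bool → ℕ × Data × Data × Data → Bool := fun b x =>
    if D (x.1, x.2.1.left, T x.1 x.2.1.right x.2.2.1 x.2.2.2) then b else !b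
  have hA₂ : ∀ b, PolyTime (A₂ b) := by
    intro b
    have hin : PT (fun x : ℕ × Data × Data × Data => code x) _ := .self
    refine polyTime_iff.2 (((hD.pt (fun x : ℕ × Data × Data × Data =>
      (x.1, x.2.1.left, T x.1 x.2.1.right x.2.2.1 x.2.2.2)) (hin.left.node
        (hin.right.left.left.node (hT.pt (fun x : ℕ × Data × Data × Data =>
          (x.1, x.2.1.right, x.2.2.1, x.2.2.2)) (hin.left.node (hin.right.left.right.node
            (hin.right.right.left.node hin.right.right.right))))))).ite_bool
      (.const (code b)) (.const (code !b))).congr fun x => ?_)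
    simp only [A₂]
    split <;> rfl
  obtain ⟨μ, hμ, hμ'⟩ := h _ _ hA₁ (hA₂ true) (1 + p + q)
  obtain ⟨ν, hν, hν'⟩ := h _ _ hA₁ (hA₂ false) (1 + p + q)
  -- The excess over 1/2 is half the difference of the acceptance probabilities, whence twice `|μ κ|
  -- + |ν κ|`.
  refine ⟨fun κ => (|μ κ| + |ν κ|) + (|μ κ| + |ν κ|),
    (hμ.abs.add hν.abs).add (hμ.abs.add hν.abs), fun κ i hi z hz => ?_⟩
  rw [hX, hX]
  refine abs_acceptProb_bind_sub_le fun v hv => ?_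
  have hsize : (Data.node z v).size ≤ (1 + p + q).eval κ := by
    have := hR κ i hi v hv
    simp only [Data.size, Polynomial.eval_add, Polynomial.eval_one]
    omega
  have h1 := hμ' κ _ hsize
  have h2 := hν' κ _ hsize
  rw [A.cpaExperiment_bit] at h1 h2
  set Y : Bool → PMF Bool := fun b =>
    (bits (A.kgenCoins κ)).bind fun r => (bits (A.encCoins κ)).map fun r' =>
      D (κ, z, T κ v (A.kgen κ r).2
        (A.enc κ (A.kgen κ r).2 (A.bit κ (A.kgen κ r).2 b) r')) with hY
  have e0 : ∀ b, acceptProb D κ z ((bits (A.kgenCoins κ)).bind fun r =>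
      (bits (A.encCoins κ)).map fun r' => T κ v (A.kgen κ r).2
        (A.enc κ (A.kgen κ r).2 (A.bit κ (A.kgen κ r).2 b) r')) = (Y b true).toReal := by
    intro b
    simp only [acceptProb, PMF.map_bind, PMF.map_comp, hY]
    rfl
  have e1 : ∀ b, ((bits (A.kgenCoins κ)).bind fun r => (bits (A.encCoins κ)).map fun r' =>
      A₂ true (κ, Data.node z v, (A.kgen κ r).2,
        A.enc κ (A.kgen κ r).2 (A.bit κ (A.kgen κ r).2 b) r')) = Y b := by
    intro b
    simp [A₂, hY, Data.left, Data.right]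
  have e2 : ∀ b, ((bits (A.kgenCoins κ)).bind fun r => (bits (A.encCoins κ)).map fun r' =>
      A₂ false (κ, Data.node z v, (A.kgen κ r).2,
        A.enc κ (A.kgen κ r).2 (A.bit κ (A.kgen κ r).2 b) r')) = (Y b).map not := by
    intro b
    simp only [A₂, hY, Data.left, Data.right, PMF.map_bind, PMF.map_comp]
    congr 1
    funext r
    congr 1
    funext r'
    simp only [Function.comp_apply]
    exact (by decide : ∀ x : Bool, (if x then false else !false) = !x) _
  have e3 : ∀ b, ((Y b).map not) true = Y b false := by
    intro b
    rw [PMF.map_apply, tsum_bool]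
    simp
  rw [e1, e1] at h1
  rw [e2, e2, e3, e3, toReal_apply_not, toReal_apply_not] at h2
  rw [e0, e0, abs_le]
  have := le_abs_self (μ κ)
  have := le_abs_self (ν κ)
  have := abs_nonneg (μ κ)
  have := abs_nonneg (ν κ)
  constructor <;> linarith

/-! ### Sums of vectors of ciphertexts -/

section Fold

variable {R : Type} [AddCommMonoid R] {G : Data → R → Prop} {op op' : Data → Data → Data}

/-- Read `G x v` as "`x` is a ciphertext that decrypts to `v`", `op` as homomorphic addition and
`op'` as its capped version. Equality of the two and correctness are proved together, since the cap
is harmless only on genuine ciphertexts. -/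
theorem zipWith_op_spec
    (hop : ∀ x y v v', G x v → G y v' → op' x y = op x y ∧ G (op x y) (v + v'))
    {x y : List Data} {v v' : List R} (hx : List.Forall₂ G x v) (hy : List.Forall₂ G y v') :
    List.zipWith op' x y = List.zipWith op x y ∧
      List.Forall₂ G (List.zipWith op x y) (List.zipWith (· + ·) v v') := by
  induction hx generalizing y v' with
  | nil => simp
  | cons h _ ih =>
    cases hy with
    | nil => simp
    | cons h' hy =>
      have h1 := hop _ _ _ _ h h'
      have h2 := ih hy
      exact ⟨by simp [h1.1, h2.1], by simp [h1.2, h2.2]⟩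

theorem zipWith_add_replicate_zero (v : List R) :
    List.zipWith (· + ·) v (List.replicate v.length 0) = v := by
  induction v with
  | nil => rfl
  | cons a v ih => simp [List.replicate_succ, ih]

theorem foldl_zipWith_zero
    (hop : ∀ x y v v', G x v → G y v' → op' x y = op x y ∧ G (op x y) (v + v'))
    {rows : List (List Data)} {x : List Data} {v : List R} (hx : List.Forall₂ G x v)
    (h : ∀ row ∈ rows, List.Forall₂ G row (List.replicate v.length 0)) :
    rows.foldl (List.zipWith op') x = rows.foldl (List.zipWith op) x ∧
      List.Forall₂ G (rows.foldl (List.zipWith op) x) v := by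
  induction rows generalizing x with
  | nil => exact ⟨rfl, hx⟩
  | cons row rows ih =>
    obtain ⟨h1, h2⟩ := zipWith_op_spec hop hx (h row (by simp))
    rw [zipWith_add_replicate_zero] at h2
    rw [List.foldl_cons, List.foldl_cons, h1]
    exact ih h2 fun row hr => h row (by simp [hr])

/-- The sum of a list of vectors all of which but one encrypt zero. -/
theorem foldl_zipWith_single
    (hop : ∀ x y v v', G x v → G y v' → op' x y = op x y ∧ G (op x y) (v + v'))
    {front back : List (List Data)} {row : List Data} {v : List R}
    (hrow : List.Forall₂ G row v)
    (hfront : ∀ x ∈ front, List.Forall₂ G x (List.replicate v.length 0))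
    (hback : ∀ x ∈ back, List.Forall₂ G x (List.replicate v.length 0)) :
    let rows := front ++ row :: back
    rows.tail.foldl (List.zipWith op') (rows.headD []) =
        rows.tail.foldl (List.zipWith op) (rows.headD []) ∧
      List.Forall₂ G (rows.tail.foldl (List.zipWith op) (rows.headD [])) v := by
  -- The sum starts from its first row rather than from zero, so it matters whether the
  -- distinguished row comes first.
  cases front with
  | nil => exact foldl_zipWith_zero hop hrow hback
  | cons x front =>
    obtain ⟨h1, h2⟩ := foldl_zipWith_zero hop (rows := front) (hfront x (by simp))
      fun y hy => by simpa using hfront y (by simp [hy])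
    obtain ⟨h3, h4⟩ := zipWith_op_spec hop h2 hrow
    have h5 : List.zipWith (· + ·) (List.replicate v.length 0) v = v := by
      rw [List.zipWith_comm_of_comm (fun a b => add_comm a b), zipWith_add_replicate_zero]
    rw [h5] at h4
    simp only [List.cons_append, List.tail_cons, List.headD_cons, List.foldl_append,
      List.foldl_cons, h1, h3]
    exact foldl_zipWith_zero hop h4 hback

end Fold

/-! ### The homomorphic inner product with a one-hot vector -/

theorem AHE.bit_eq (A : AHE) (κ : ℕ) (pk : Data) (b : Bool) :
    A.bit κ pk b = ((if b then 1 else 0 : A.Plain κ pk) : Data) := by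
  cases b <;> rfl

theorem hsum_eq_foldl (A : AHE) (κ : ℕ) (pk : Data) (rows : List (List Data)) :
    hsum A κ pk rows = rows.tail.foldl (List.zipWith (A.hadd κ pk)) (rows.headD []) := by
  cases rows <;> rfl

theorem length_encOneHot (A : AHE) (κ : ℕ) (pk : Data) (n s : ℕ) (r : List Bool) :
    (encOneHot A κ pk n s r).length = n := by simp [encOneHot]

theorem length_block {r : List Bool} {n k e : ℕ} (hr : r.length = n * e) (hk : k < n) :
    ((r.drop (k * e)).take e).length = e := by
  have : (k + 1) * e ≤ n * e := Nat.mul_le_mul_right _ hk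
  rw [List.length_take, List.length_drop, hr]
  rw [add_mul] at this
  omega

/-- The homomorphic inner product consists of ciphertexts of the selected entry, and capping the
ciphertexts at their maximal size does not change it. -/
theorem compress_spec (A : AHE) {κ : ℕ} {r : List Bool} (hr : r.length = A.kgenCoins κ) {B : ℕ}
    (hB : ∀ c ∈ A.Cipher κ (A.kgen κ r).2, c.size ≤ B) {w n s : ℕ} (hs : s < n)
    {res : List (List Data)} (hlen : res.length = n)
    (hres : ∀ e ∈ res, e.length = w ∧ ∀ x ∈ e, x ∈ A.Plain κ (A.kgen κ r).2)
    {r' : List Bool} (hr' : r'.length = n * A.encCoins κ) :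
    let pk := (A.kgen κ r).2
    let b := encOneHot A κ pk n s r'
    cappedCompress A B κ pk b (res.map listData) = compress A κ pk b res ∧
      (∀ c ∈ compress A κ pk b res, c ∈ A.Cipher κ pk) ∧
      (compress A κ pk b res).map (A.dec κ (A.kgen κ r).1) = res.getD s [] := by
  intro pk b
  let G : Data → A.Plain κ pk → Prop :=
    fun c a => c ∈ A.Cipher κ pk ∧ A.dec κ (A.kgen κ r).1 c = a
  have hop : ∀ x y v v', G x v → G y v' →
      (A.hadd κ pk x y).cap B = A.hadd κ pk x y ∧ G (A.hadd κ pk x y) (v + v') := by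
    rintro x y v v' ⟨hx, hx'⟩ ⟨hy, hy'⟩
    have h := A.hadd_spec κ r hr x hx y hy v v' hx' hy'
    exact ⟨Data.cap_of_le (hB _ h.1), h⟩
  have hb : ∀ k (hk : k < b.length), G b[k] (if k = s then 1 else 0) := by
    intro k hk
    have hk' : k < n := by simpa [b, length_encOneHot] using hk
    have h := A.enc_spec κ r hr (if k = s then 1 else 0) _ (length_block hr' hk')
    have e : b[k] = A.enc κ pk ((if k = s then 1 else 0 : A.Plain κ pk) : Data)
        ((r'.drop (k * A.encCoins κ)).take (A.encCoins κ)) := by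
      simp only [b, encOneHot, List.getElem_map, List.getElem_range, AHE.bit_eq]
      simp
    rw [e]
    exact h
  have hblen : b.length = n := length_encOneHot ..
  set rows : List (List Data) :=
    List.zipWith (fun c e => e.map fun x => A.hmul κ pk c x) b res with hrows
  have hrlen : rows.length = n := by simp [rows, hblen, hlen]
  -- Row `k` encrypts entry `k` multiplied by the `k`-th coordinate of the one-hot vector.
  have hrow : ∀ k (hk : k < n), ∃ v : List (A.Plain κ pk),
      v.map Subtype.val = res[k] ∧ v.length = w ∧
      List.Forall₂ G rows[k] (v.map ((if k = s then 1 else 0) * ·)) := by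
    intro k hk
    obtain ⟨h1, h2⟩ := hres _ (List.getElem_mem (show k < res.length by omega))
    obtain ⟨v, hv⟩ : ∃ v : List (A.Plain κ pk), v.map Subtype.val = res[k] :=
      CanLift.prf (α := List Data) (β := List (A.Plain κ pk)) _ h2
    refine ⟨v, hv, by rw [← h1, ← hv, List.length_map], ?_⟩
    have e : rows[k] = v.map fun x : A.Plain κ pk => A.hmul κ pk b[k] (x : Data) := by
      simp only [rows, List.getElem_zipWith, ← hv, List.map_map]
      rfl
    rw [e, List.forall₂_map_left_iff, List.forall₂_map_right_iff, List.forall₂_same]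
    intro x _
    obtain ⟨h3, h4⟩ := hb k (by omega)
    exact A.hmul_spec κ r hr _ h3 _ x h4
  have hcapped : List.zipWith (fun c e => e.toList.map fun x => (A.hmul κ pk c x).cap B) b
      (res.map listData) = rows := by
    apply List.ext_getElem
    · simp [rows]
    · intro k hk hk'
      simp only [List.getElem_zipWith, List.getElem_map, toList_listData, rows]
      refine List.map_congr_left fun x hx => Data.cap_of_le (hB _ ?_)
      obtain ⟨h3, h4⟩ := hb k (by omega)
      exact (A.hmul_spec κ r hr _ h3 _
        ⟨x, (hres _ (List.getElem_mem (show k < res.length by omega))).2 x hx⟩ h4).1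
  obtain ⟨v, hv, hvlen, hvs⟩ := hrow s hs
  have hzero : ∀ k (hk : k < n), k ≠ s →
      List.Forall₂ G rows[k] (List.replicate v.length 0) := by
    intro k hk hks
    obtain ⟨v', _, h2, h3⟩ := hrow k hk
    simpa [hks, h2, hvlen] using h3
  simp only [if_true, one_mul, List.map_id'] at hvs
  -- Isolates the one row that does not encrypt zeros, in the form needed by `foldl_zipWith_single`.
  have hsplit : rows = rows.take s ++ rows[s] :: rows.drop (s + 1) := by
    rw [← List.drop_eq_getElem_cons, List.take_append_drop]
  obtain ⟨h1, h2⟩ := foldl_zipWith_single hop hvs (front := rows.take s)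
    (back := rows.drop (s + 1))
    (fun x hx => by
      obtain ⟨k, hk, rfl⟩ := List.mem_iff_getElem.1 hx
      rw [List.length_take] at hk
      rw [List.getElem_take]
      exact hzero k (by omega) (by omega))
    (fun x hx => by
      obtain ⟨k, hk, rfl⟩ := List.mem_iff_getElem.1 hx
      rw [List.length_drop] at hk
      rw [List.getElem_drop]
      exact hzero _ (by omega) (by omega))
  rw [← hsplit] at h1 h2
  have hc : compress A κ pk b res =
      rows.tail.foldl (List.zipWith (A.hadd κ pk)) (rows.headD []) := hsum_eq_foldl ..
  refine ⟨?_, ?_, ?_⟩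
  · rw [hc, ← h1, cappedCompress, hcapped]
  · intro c hcm
    rw [hc] at hcm
    obtain ⟨k, hk, rfl⟩ := List.mem_iff_getElem.1 hcm
    exact (List.forall₂_iff_get.1 h2).2 k hk (h2.length_eq ▸ hk) |>.1
  · rw [hc, List.getD_eq_getElem _ _ (by omega), ← hv]
    apply List.ext_getElem
    · rw [List.length_map, List.length_map, h2.length_eq]
    · intro k hk hk'
      rw [List.length_map] at hk hk'
      simp only [List.getElem_map]
      exact ((List.forall₂_iff_get.1 h2).2 k hk hk').2

/-! ### Executions of the compiled protocol -/

/-- The coins of an execution of the compiled protocol used in the underlying protocol. -/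
def Exec.inner (P : VecOT) (κ : ℕ) (e : Exec) : Exec :=
  { e with r₁ := e.r₁.take (P.queryCoins κ e.n) }

/-- The coins for the receiver's key pair. -/
def Exec.keyCoins (P : VecOT) (A : AHE) (κ : ℕ) (e : Exec) : List Bool :=
  (e.r₁.drop (P.queryCoins κ e.n)).take (A.kgenCoins κ)

/-- The coins for the encryption of the receiver's index. -/
def Exec.vecCoins (P : VecOT) (A : AHE) (κ : ℕ) (e : Exec) : List Bool :=
  (e.r₁.drop (P.queryCoins κ e.n)).drop (A.kgenCoins κ)

section

variable {P : VecOT} {A : AHE} {U : ℕ → Set Data} {κ : ℕ} {e : Exec}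

theorem honest_inner (h : (compile P A).Honest U κ e) : P.toOT.Honest U κ (e.inner P κ) := by
  obtain ⟨h1, h2, h3, h4, h5, h6⟩ := h
  refine ⟨h1, h2, h3, h4, ?_, h6⟩
  simp only [Exec.inner, List.length_take, h5, compile, VecOT.toOT]
  omega

theorem length_keyCoins (h : (compile P A).Honest U κ e) :
    (e.keyCoins P A κ).length = A.kgenCoins κ := by
  obtain ⟨h1, h2, h3, h4, h5, h6⟩ := h
  simp only [Exec.keyCoins, List.length_take, List.length_drop, h5, compile]
  omega

theorem length_vecCoins (h : (compile P A).Honest U κ e) :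
    (e.vecCoins P A κ).length = e.n * A.encCoins κ := by
  obtain ⟨h1, h2, h3, h4, h5, h6⟩ := h
  simp only [Exec.vecCoins, List.length_drop, h5, compile]
  omega

theorem compile_query (P : VecOT) (A : AHE) (κ : ℕ) (e : Exec) : (compile P A).query κ e =
    ((A.kgen κ (e.keyCoins P A κ)).2, P.toOT.query κ (e.inner P κ),
      encOneHot A κ (A.kgen κ (e.keyCoins P A κ)).2 e.n e.s (e.vecCoins P A κ)) := rfl

theorem compile_secret (P : VecOT) (A : AHE) (κ : ℕ) (e : Exec) : (compile P A).secret κ e =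
    (P.toOT.secret κ (e.inner P κ), (A.kgen κ (e.keyCoins P A κ)).1) := rfl

theorem compile_response_spec {w : ℕ → ℕ} (hfit : P.Fits A U w)
    (h : (compile P A).Honest U κ e) {B : ℕ}
    (hB : ∀ r, r.length = A.kgenCoins κ → ∀ c ∈ A.Cipher κ (A.kgen κ r).2, c.size ≤ B) :
    let pk := (A.kgen κ (e.keyCoins P A κ)).2
    cappedCompress A B κ pk (encOneHot A κ pk e.n e.s (e.vecCoins P A κ))
        ((P.toOT.response κ (e.inner P κ)).map listData) = (compile P A).response κ e ∧
      (∀ c ∈ (compile P A).response κ e, c ∈ A.Cipher κ pk) ∧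
      ((compile P A).response κ e).map (A.dec κ (A.kgen κ (e.keyCoins P A κ)).1) =
        (P.toOT.response κ (e.inner P κ)).getD e.s [] := by
  obtain ⟨h1, h2⟩ := hfit κ _ (honest_inner h)
  exact compress_spec A (length_keyCoins h) (hB _ (length_keyCoins h)) h.1 h1
    (fun v hv => ⟨(h2 v hv).1, fun x hx => (h2 v hv).2 x hx _ (length_keyCoins h)⟩)
    (length_vecCoins h)

theorem compile_output {w : ℕ → ℕ} (hfit : P.Fits A U w) (h : (compile P A).Honest U κ e) :
    (compile P A).output κ e = P.toOT.output κ (e.inner P κ) := by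
  obtain ⟨B, hB⟩ := A.cipher_size
  have h3 := (compile_response_spec hfit h (hB κ)).2.2
  show P.retrieveEntry κ (((compile P A).response κ e).map
    (A.dec κ (A.kgen κ (e.keyCoins P A κ)).1)) _ _ _ _ = _
  rw [h3]
  rfl

theorem compile_correct {w : ℕ → ℕ} (hfit : P.Fits A U w) (h : P.toOT.Correct U) :
    (compile P A).Correct U := fun κ e he => by
  rw [compile_output hfit he, h κ _ (honest_inner he)]
  rfl

end

/-! ### Polynomial size of the messages of a protocol -/

namespace PolyBound

variable {ι : Type} {a : ι → ℕ}

theorem size_unary {n : ι → ℕ} (h : PolyBound a n) : PolyBound a fun i => (unary (n i)).size :=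
  (((PolyBound.const 2).mul h).add (.const 1)).mono fun i => (ThinOT.size_unary (n i)).le

theorem of_size_unary {n : ι → ℕ} (h : PolyBound a fun i => (unary (n i)).size) :
    PolyBound a n :=
  h.mono fun i => by rw [ThinOT.size_unary]; omega

theorem size_node {b c : ι → Data} (hb : PolyBound a fun i => (b i).size)
    (hc : PolyBound a fun i => (c i).size) :
    PolyBound a fun i => (Data.node (b i) (c i)).size :=
  (((PolyBound.const 1).add hb).add hc).mono fun _ => le_rfl

theorem size_bits {r : ι → List Bool} (h : PolyBound a fun i => (r i).length) :
    PolyBound a fun i => (code (r i) : Data).size :=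
  ((PolyBound.const 1).add (h.mul (.const 4))).mono fun i => size_code_bits_le (r i)

theorem size_listData {l : ι → List Data} {n M : ι → ℕ} (hn : PolyBound a n) (hM : PolyBound a M)
    (h1 : ∀ i, (l i).length ≤ n i) (h2 : ∀ i, ∀ x ∈ l i, x.size ≤ M i) :
    PolyBound a fun i => (listData (l i)).size :=
  ((PolyBound.const 1).add (hn.mul ((PolyBound.const 1).add hM))).mono fun i =>
    size_listData_le (h1 i) (h2 i)

theorem size_code {α β : Type} [Coded α] [Coded β] {S : Set α} {f : α → β}
    (h : PolyTimeOn S f) {g : ι → α} (hS : ∀ i, g i ∈ S)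
    (hg : PolyBound a fun i => (code (g i) : Data).size) :
    PolyBound a fun i => (code (f (g i)) : Data).size :=
  hg.trans (((polyTimeOn_iff.1 h).size_bound).reindex fun i => ⟨g i, hS i⟩)

theorem nat {f : ℕ → ℕ} (h : PolyTime f) {n : ι → ℕ} (hn : PolyBound a n) :
    PolyBound a fun i => f (n i) :=
  of_size_unary (size_code h (g := n) (fun _ => trivial) hn.size_unary)

theorem nat₂ {f : ℕ → ℕ → ℕ} (h : PolyTime fun x : ℕ × ℕ => f x.1 x.2) {m n : ι → ℕ}
    (hm : PolyBound a m) (hn : PolyBound a n) : PolyBound a fun i => f (m i) (n i) :=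
  of_size_unary (size_code h (g := fun i => (m i, n i)) (fun _ => trivial)
    (hm.size_unary.size_node hn.size_unary))

end PolyBound

section

variable {Q Sp Res : Type} {P : OT Q Sp Res} {U : ℕ → Set Data}
  {σ p : Polynomial ℕ} {ι : Type} {κ : ι → ℕ} {e : ι → Exec}

theorem size_messages (hU : ∀ κ, ∀ x ∈ U κ, x.size ≤ σ.eval κ)
    (he : ∀ i, P.Honest U (κ i) (e i)) (hn : ∀ i, (e i).n ≤ p.eval (κ i)) :
    PolyBound κ fun i => (code (e i).m : Data).size := by
  simp only [code_listData]
  exact PolyBound.size_listData (PolyBound.self.eval p) (PolyBound.self.eval σ)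
    (fun i => (he i).2.1.trans_le (hn i)) fun i x hx => hU _ _ ((he i).2.2.1 x hx)

variable [Coded Q] [Coded Sp] [Coded Res]

theorem OT.Efficient.size_r₀ (h : P.Efficient U) (he : ∀ i, P.Honest U (κ i) (e i)) :
    PolyBound κ fun i => (code (e i).r₀ : Data).size :=
  ((PolyBound.nat h.initCoins .self).mono fun i => (he i).2.2.2.1.le).size_bits

theorem OT.Efficient.size_r₂ (h : P.Efficient U) (he : ∀ i, P.Honest U (κ i) (e i))
    (hn : ∀ i, (e i).n ≤ p.eval (κ i)) :
    PolyBound κ fun i => (code (e i).r₂ : Data).size :=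
  ((PolyBound.nat₂ h.resCoins .self ((PolyBound.self.eval p).mono hn)).mono
    fun i => (he i).2.2.2.2.2.le).size_bits

theorem OT.Efficient.size_pk (h : P.Efficient U) (he : ∀ i, P.Honest U (κ i) (e i)) :
    PolyBound κ fun i => (P.pk (κ i) (e i)).size :=
  PolyBound.size_code h.init (g := fun i => (κ i, (e i).r₀)) (fun i => ⟨_, _, he i, rfl⟩)
    (PolyBound.self.size_unary.size_node (h.size_r₀ he))

theorem OT.Efficient.size_query (h : P.Efficient U) (he : ∀ i, P.Honest U (κ i) (e i))
    (hn : ∀ i, (e i).n ≤ p.eval (κ i)) :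
    PolyBound κ fun i => (code (P.query (κ i) (e i)) : Data).size := by
  have hn' : PolyBound κ fun i => (e i).n := (PolyBound.self.eval p).mono hn
  have hq : PolyBound κ fun i => _ := PolyBound.size_code h.genQuery
    (g := fun i => (κ i, P.pk (κ i) (e i), (e i).n, (e i).s, (e i).r₁))
    (fun i => ⟨_, _, he i, rfl⟩)
    (PolyBound.self.size_unary.size_node ((h.size_pk he).size_node (hn'.size_unary.size_node
      ((hn'.mono fun i => (he i).1.le).size_unary.size_node
        ((PolyBound.nat₂ h.queryCoins .self hn').mono
          fun i => (he i).2.2.2.2.1.le).size_bits))))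
  exact hq.mono fun i => Data.left_size_le
    (code (P.genQuery (κ i) (P.pk (κ i) (e i)) (e i).n (e i).s (e i).r₁))

theorem OT.Efficient.size_response (h : P.Efficient U) (hU : ∀ κ, ∀ x ∈ U κ, x.size ≤ σ.eval κ)
    (he : ∀ i, P.Honest U (κ i) (e i)) (hn : ∀ i, (e i).n ≤ p.eval (κ i)) :
    PolyBound κ fun i => (code (P.response (κ i) (e i)) : Data).size :=
  PolyBound.size_code h.genRes
    (g := fun i => (κ i, (e i).m, P.pk (κ i) (e i), P.query (κ i) (e i), (e i).r₂))
    (fun i => ⟨_, _, he i, rfl⟩)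
    (PolyBound.self.size_unary.size_node ((size_messages hU he hn).size_node
      ((h.size_pk he).size_node ((h.size_query he hn).size_node (h.size_r₂ he hn)))))

end

theorem code_listListData (l : List (List Data)) : (code l : Data) = listData (l.map listData) := by
  show listData (l.map code) = _
  simp only [show (code : List Data → Data) = listData from funext code_listData]

section

variable {P : VecOT} {A : AHE} {U : ℕ → Set Data} {w : ℕ → ℕ} {σ : Polynomial ℕ}

/-- The number of values in an entry is polynomial, since it does not depend on the number of
messages and there are executions with a single message. -/
theorem width_bound (hU : ∀ κ, ∀ x ∈ U κ, x.size ≤ σ.eval κ) (hfit : P.Fits A U w)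
    (heff : P.Efficient U) :
    ∃ W : Polynomial ℕ, ∀ κ e, P.toOT.Honest U κ e → w κ ≤ W.eval κ := by
  obtain ⟨W, hW⟩ := heff.toOT.size_response (p := 1)
    (ι := {x : ℕ × Exec // P.toOT.Honest U x.1 x.2 ∧ x.2.n ≤ 1})
    (κ := fun x => x.1.1) (e := fun x => x.1.2) hU (fun x => x.2.1) (fun x => by simpa using x.2.2)
  refine ⟨W, fun κ e he => ?_⟩
  obtain ⟨x, hx⟩ : ∃ x, x ∈ e.m := by
    have := he.1
    have := he.2.1
    exact List.exists_mem_of_length_pos (by omega)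
  -- `w κ` is constrained only where an honest execution exists. A message and the initial coins of
  -- the given one, with arbitrary remaining coins, yield an honest execution with a single message.
  let e' : Exec := ⟨1, 0, [x], e.r₀, List.replicate (P.toOT.queryCoins κ 1) false,
    List.replicate (P.toOT.resCoins κ 1) false⟩
  have he' : P.toOT.Honest U κ e' := ⟨Nat.one_pos, rfl, by simpa [e'] using he.2.2.1 x hx,
    he.2.2.2.1, by simp [e'], by simp [e']⟩
  obtain ⟨h1, h2⟩ := hfit κ e' he'
  obtain ⟨v, hv⟩ : ∃ v, v ∈ P.toOT.response κ e' :=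
    List.exists_mem_of_length_pos (by rw [h1]; exact Nat.one_pos)
  have h3 : (code (P.toOT.response κ e')).size ≤ W.eval κ := hW ⟨(κ, e'), he', le_rfl⟩
  rw [code_listListData] at h3
  rw [← (h2 v hv).1]
  exact ((length_le_size_listData v).trans
    (size_le_size_listData (List.mem_map_of_mem hv))).trans h3

theorem compile_response_size (hU : ∀ κ, ∀ x ∈ U κ, x.size ≤ σ.eval κ) (hfit : P.Fits A U w)
    (heff : P.Efficient U) :
    ∃ K : Polynomial ℕ, ∀ κ e, (compile P A).Honest U κ e →
      ((compile P A).response κ e).length = w κ ∧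
      (code ((compile P A).response κ e)).size ≤ K.eval κ := by
  obtain ⟨W, hW⟩ := width_bound hU hfit heff
  obtain ⟨B, hB⟩ := A.cipher_size
  refine ⟨1 + W * (1 + B), fun κ e he => ?_⟩
  obtain ⟨_, h2, h3⟩ := compile_response_spec hfit he (hB κ)
  have hlen : ((compile P A).response κ e).length = w κ := by
    -- Decryption acts value by value, so the response is as long as the entry it decrypts to.
    have h4 := congrArg List.length h3
    obtain ⟨h5, h6⟩ := hfit κ _ (honest_inner he)
    have hs : e.s < (P.toOT.response κ (e.inner P κ)).length := h5 ▸ he.1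
    rw [List.length_map, List.getD_eq_getElem _ _ hs] at h4
    rw [h4, (h6 _ (List.getElem_mem _)).1]
  refine ⟨hlen, ?_⟩
  rw [code_listData]
  simpa using size_listData_le (hlen.trans_le (hW κ _ (honest_inner he)))
    fun c hc => hB κ _ (length_keyCoins he) c (h2 c hc)

/-! ### Efficiency of the compiled protocol -/

theorem compile_efficient (hfit : P.Fits A U w) (heff : P.Efficient U) :
    (compile P A).Efficient U := by
  obtain ⟨B, hB⟩ := A.cipher_size
  have hq : PolyTime fun x : ℕ × ℕ => P.queryCoins x.1 x.2 := heff.toOT.queryCoins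
  let ι := {x : ℕ × Exec // (compile P A).Honest U x.1 x.2}
  refine ⟨heff.toOT.initCoins, ?_, heff.toOT.resCoins, ?_, ?_, ?_, ?_⟩
  · have hin : PT (fun x : ℕ × ℕ => code x) _ := .self
    have hκ : PT (fun x : ℕ × ℕ => code x) fun x => unary x.1 := hin.left
    have hn : PT (fun x : ℕ × ℕ => code x) fun x => unary x.2 := hin.right
    exact polyTime_iff.2 (PT.add (hq.pt (fun x => x) hin)
      ((hκ.kgenCoins A).add (hn.mul (hκ.encCoins A))))
  · refine polyTimeOn_of_pt (g := fun i : ι => (i.1.1, i.1.2.r₀))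
      (fun x ⟨κ, e, h, hx⟩ => ⟨⟨(κ, e), h⟩, hx⟩) ?_
    exact PolyTimeOn.pt heff.toOT.init (g := fun i : ι => (i.1.1, i.1.2.r₀))
      (fun i => ⟨_, _, honest_inner i.2, rfl⟩) .self
  · refine polyTimeOn_of_pt (g := fun i : ι =>
      (i.1.1, (compile P A).pk i.1.1 i.1.2, i.1.2.n, i.1.2.s, i.1.2.r₁))
      (fun x ⟨κ, e, h, hx⟩ => ⟨⟨(κ, e), h⟩, hx⟩) ?_
    set env : ι → Data := fun i =>
      code (i.1.1, (compile P A).pk i.1.1 i.1.2, i.1.2.n, i.1.2.s, i.1.2.r₁)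
    have hin : PT env env := .self
    have hκ : PT env fun i => unary i.1.1 := hin.left
    have hpk : PT env fun i => (compile P A).pk i.1.1 i.1.2 := hin.right.left
    have hn : PT env fun i => unary i.1.2.n := hin.right.right.left
    have hs : PT env fun i => unary i.1.2.s := hin.right.right.right.left
    have hr : PT env fun i => code i.1.2.r₁ := hin.right.right.right.right
    have hqc : PT env fun i => unary (P.queryCoins i.1.1 i.1.2.n) :=
      hq.pt (fun i : ι => (i.1.1, i.1.2.n)) (hκ.node hn)
    have hgq := PolyTimeOn.pt heff.toOT.genQuery (g := fun i : ι => (i.1.1,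
      P.toOT.pk i.1.1 (i.1.2.inner P i.1.1), i.1.2.n, i.1.2.s,
      i.1.2.r₁.take (P.queryCoins i.1.1 i.1.2.n)))
      (fun i => ⟨_, _, honest_inner i.2, rfl⟩)
      (hκ.node (hpk.node (hn.node (hs.node (hqc.take_bits hr)))))
    have hkc : PT env fun i => unary (A.kgenCoins i.1.1) := hκ.kgenCoins A
    have hkg := hκ.kgen A (hkc.take_bits (hqc.drop_bits hr))
    have hv := hκ.encOneHot A hkg.right hn hs (hkc.drop_bits (hqc.drop_bits hr))
    refine ((hkg.right.node (hgq.left.node hv)).node (hgq.right.node hkg.left)).congr fun i => ?_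
    rw [← code_listData]
    rfl
  · refine polyTimeOn_of_pt (g := fun i : ι => (i.1.1, i.1.2.m,
      (compile P A).pk i.1.1 i.1.2, (compile P A).query i.1.1 i.1.2, i.1.2.r₂))
      (fun x ⟨κ, e, h, hx⟩ => ⟨⟨(κ, e), h⟩, hx⟩) ?_
    set env : ι → Data := fun i => code (i.1.1, i.1.2.m,
      (compile P A).pk i.1.1 i.1.2, (compile P A).query i.1.1 i.1.2, i.1.2.r₂)
    have hin : PT env env := .self
    have hκ : PT env fun i => unary i.1.1 := hin.left
    have hq := hin.right.right.right.left
    have hres := PolyTimeOn.pt heff.toOT.genRes (g := fun i : ι => (i.1.1, i.1.2.m,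
      P.toOT.pk i.1.1 (i.1.2.inner P i.1.1), P.toOT.query i.1.1 (i.1.2.inner P i.1.1), i.1.2.r₂))
      (fun i => ⟨_, _, honest_inner i.2, rfl⟩)
      (hκ.node (hin.right.left.node (hin.right.right.left.node
        (hq.right.left.node hin.right.right.right.right))))
    -- The program runs the capped inner product; on honest executions it returns the true response.
    refine (PT.cappedCompress A (hκ.eval B) hκ hq.left
      (hq.right.right.congr fun i => code_listData _)
      (hres.congr fun i => code_listListData _)).congr fun i => ?_
    rw [← code_listData]
    exact congrArg code (compile_response_spec hfit i.2 (hB i.1.1)).1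
  · refine polyTimeOn_of_pt (g := fun i : ι => (i.1.1, (compile P A).response i.1.1 i.1.2,
      (compile P A).query i.1.1 i.1.2, (compile P A).secret i.1.1 i.1.2,
      (compile P A).pk i.1.1 i.1.2, i.1.2.s))
      (fun x ⟨κ, e, h, hx⟩ => ⟨⟨(κ, e), h⟩, hx⟩) ?_
    set env : ι → Data := fun i => code (i.1.1, (compile P A).response i.1.1 i.1.2,
      (compile P A).query i.1.1 i.1.2, (compile P A).secret i.1.1 i.1.2,
      (compile P A).pk i.1.1 i.1.2, i.1.2.s)
    have hin : PT env env := .self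
    have hκ : PT env fun i => unary i.1.1 := hin.left
    have hres : PT env fun i => listData ((compile P A).response i.1.1 i.1.2) :=
      hin.right.left.congr fun i => code_listData _
    have hsk : PT env fun i => ((compile P A).secret i.1.1 i.1.2).2 :=
      hin.right.right.right.left.right
    have hdec := hres.map (f := fun i => A.dec i.1.1 ((compile P A).secret i.1.1 i.1.2).2)
      (A.dec_polyTime.pt (fun p : Σ i : ι, {x // x ∈ (compile P A).response i.1.1 i.1.2} =>
        (p.1.1.1, ((compile P A).secret p.1.1.1 p.1.1.2).2, (p.2 : Data)))
        ((hκ.fst _ _).node ((hsk.fst _ _).node PT.self.right)))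
    -- The extraction is known to be fast only on genuine entries `e_s`; the decrypted response is
    -- such an entry.
    exact PolyTimeOn.pt heff.retrieveEntry (g := fun i : ι => (i.1.1,
      ((compile P A).response i.1.1 i.1.2).map
        (A.dec i.1.1 ((compile P A).secret i.1.1 i.1.2).2),
      ((compile P A).query i.1.1 i.1.2).2.1, ((compile P A).secret i.1.1 i.1.2).1,
      (compile P A).pk i.1.1 i.1.2, i.1.2.s))
      (fun i => ⟨i.1.1, i.1.2.inner P i.1.1, honest_inner i.2, by
        have := (compile_response_spec hfit i.2 (hB i.1.1)).2.2
        rw [compile_secret, this]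
        rfl⟩)
      (hκ.node ((hdec.congr fun i => (code_listData _).symm).node
        (hin.right.right.left.right.left.node (hin.right.right.right.left.left.node
          hin.right.right.right.right))))

end

/-! ### The receiver's additional coins and messages -/

/-- The coins of the receiver for the encryption scheme, its public key and its encrypted vector.
The index `s = n` yields encryptions of zero only. -/
def keyedVector (A : AHE) (κ n s : ℕ) (r : List Bool) : Data :=
  .node (code r) (.node (A.kgen κ (r.take (A.kgenCoins κ))).2
    (listData (encOneHot A κ (A.kgen κ (r.take (A.kgenCoins κ))).2 n s
      (r.drop (A.kgenCoins κ)))))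

/-- The number of coins for the encryption scheme. -/
def AHE.vecCoins (A : AHE) (κ n : ℕ) : ℕ := A.kgenCoins κ + n * A.encCoins κ

namespace PT

variable {ι : Type} {a : ι → Data} (A : AHE) {κ n s : ι → ℕ} {r : ι → List Bool}

theorem keyedVector (hκ : PT a fun i => unary (κ i)) (hn : PT a fun i => unary (n i))
    (hs : PT a fun i => unary (s i)) (hr : PT a fun i => code (r i)) :
    PT a fun i => keyedVector A (κ i) (n i) (s i) (r i) := by
  have hpk := (hκ.kgen A ((hκ.kgenCoins A).take_bits hr)).right
  exact hr.node (hpk.node (hκ.encOneHot A hpk hn hs ((hκ.kgenCoins A).drop_bits hr)))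

theorem vecCoins (hκ : PT a fun i => unary (κ i)) (hn : PT a fun i => unary (n i)) :
    PT a fun i => unary (A.vecCoins (κ i) (n i)) :=
  (hκ.kgenCoins A).add (hn.mul (hκ.encCoins A))

end PT

/-- The size bound is read off from polynomial-time computability, with all inputs bounded in terms
of `κ`. -/
theorem size_keyedVector (A : AHE) (p : Polynomial ℕ) : ∃ q : Polynomial ℕ, ∀ κ n s r,
    n ≤ p.eval κ → s ≤ p.eval κ → r.length = A.vecCoins κ n →
      (keyedVector A κ n s r).size ≤ q.eval κ := by
  let ι := {x : ℕ × ℕ × ℕ × List Bool // x.2.1 ≤ p.eval x.1 ∧ x.2.2.1 ≤ p.eval x.1 ∧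
    x.2.2.2.length = A.vecCoins x.1 x.2.1}
  let env : ι → Data := fun i => code i.1
  have hin : PT env env := .self
  have h := PT.keyedVector A (a := env) (κ := fun i => i.1.1) (n := fun i => i.1.2.1)
    (s := fun i => i.1.2.2.1) (r := fun i => i.1.2.2.2) hin.left hin.right.left
    hin.right.right.left hin.right.right.right
  have hκ : PolyBound (fun i : ι => i.1.1) fun i => i.1.1 := .self
  have hn : PolyBound (fun i : ι => i.1.1) fun i => i.1.2.1 := (hκ.eval p).mono fun i => i.2.1
  have hs : PolyBound (fun i : ι => i.1.1) fun i => i.1.2.2.1 :=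
    (hκ.eval p).mono fun i => i.2.2.1
  have hr : PolyBound (fun i : ι => i.1.1) fun i => i.1.2.2.2.length :=
    ((PolyBound.nat A.kgenCoins_polyTime hκ).add
      (hn.mul (PolyBound.nat A.encCoins_polyTime hκ))).mono fun i => i.2.2.2.le
  have henv : PolyBound (fun i : ι => i.1.1) fun i => (env i).size :=
    hκ.size_unary.size_node (hn.size_unary.size_node (hs.size_unary.size_node hr.size_bits))
  obtain ⟨q, hq⟩ := henv.trans h.size_bound
  exact ⟨q, fun κ n s r h1 h2 h3 => hq ⟨(κ, n, s, r), h1, h2, h3⟩⟩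

/-- Splits the simulator's coins into those of the underlying simulator and those for the encryption
scheme, drawing the latter first to match `CompIndist.bind_map`. -/
theorem map_bits_add {β : Type} (a b : ℕ) (f : List Bool → List Bool → β) :
    (bits (a + b)).map (fun r => f (r.take a) (r.drop a)) =
      (bits b).bind fun r' => (bits a).map fun r => f r r' := by
  show (bits (a + b)).bind _ = (bits b).bind fun r' => (bits a).bind _
  rw [bind_bits_add, PMF.bind_comm (bits b)]
  refine bind_congr_support fun r hr => ?_
  rw [mem_support_bits] at hr
  subst hr
  simp

/-- The coins of an execution of the compiled protocol. -/
def Exec.extend (e : Exec) (r : List Bool) : Exec := { e with r₁ := e.r₁ ++ r }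

section

variable {P : VecOT} {A : AHE} {U : ℕ → Set Data} {κ : ℕ} {e : Exec} {r : List Bool}

theorem inner_extend (h : P.toOT.Honest U κ e) : (e.extend r).inner P κ = e := by
  obtain ⟨n, s, m, r₀, r₁, r₂⟩ := e
  have h5 : r₁.length = P.queryCoins κ n := h.2.2.2.2.1
  simp [Exec.extend, Exec.inner, ← h5]

theorem keyCoins_extend (h : P.toOT.Honest U κ e) :
    (e.extend r).keyCoins P A κ = r.take (A.kgenCoins κ) := by
  have h5 : e.r₁.length = P.queryCoins κ e.n := h.2.2.2.2.1
  simp [Exec.extend, Exec.keyCoins, ← h5]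

theorem vecCoins_extend (h : P.toOT.Honest U κ e) :
    (e.extend r).vecCoins P A κ = r.drop (A.kgenCoins κ) := by
  have h5 : e.r₁.length = P.queryCoins κ e.n := h.2.2.2.2.1
  simp [Exec.extend, Exec.vecCoins, ← h5]

theorem honest_extend (h : P.toOT.Honest U κ e) (hr : r.length = A.vecCoins κ e.n) :
    (compile P A).Honest U κ (e.extend r) := by
  obtain ⟨h1, h2, h3, h4, h5, h6⟩ := h
  refine ⟨h1, h2, h3, h4, ?_, h6⟩
  simp only [Exec.extend, List.length_append, hr, h5]
  rfl

end

/-- A view of the compiled protocol which is obtained from the view of the underlying protocol by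
attaching independent data. -/
theorem view_eq {P : VecOT} {A : AHE} {U : ℕ → Set Data} {κ : ℕ} {m : List Data} {s : ℕ}
    (hs : s < m.length) (hm : ∀ x ∈ m, x ∈ U κ) {F F' : Exec → Data} {T : Data → Data → Data}
    (hF : ∀ e r, P.toOT.Honest U κ e → e.n = m.length → e.s = s → e.m = m →
      r.length = A.vecCoins κ m.length →
      F' (e.extend r) = T (keyedVector A κ m.length s r) (F e)) :
    (((bits (A.vecCoins κ m.length)).map (keyedVector A κ m.length s)).bind fun v =>
      ((bits (P.toOT.initCoins κ)).bind fun r₀ => (bits (P.toOT.queryCoins κ m.length)).bind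
        fun r₁ => (bits (P.toOT.resCoins κ m.length)).bind fun r₂ =>
          PMF.pure (F ⟨m.length, s, m, r₀, r₁, r₂⟩)).map (T v)) =
    (bits ((compile P A).initCoins κ)).bind fun r₀ =>
      (bits ((compile P A).queryCoins κ m.length)).bind fun r₁ =>
        (bits ((compile P A).resCoins κ m.length)).bind fun r₂ =>
          PMF.pure (F' ⟨m.length, s, m, r₀, r₁, r₂⟩) := by
  rw [PMF.bind_map]
  simp only [PMF.map_bind, PMF.pure_map, Function.comp_def]
  -- The coins for key and vector are moved behind `r₁`, where the compiled receiver has them.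
  rw [PMF.bind_comm]
  refine bind_congr_support fun r₀ h₀ => ?_
  rw [PMF.bind_comm, show (compile P A).queryCoins κ m.length =
    P.toOT.queryCoins κ m.length + A.vecCoins κ m.length from rfl, bind_bits_add]
  refine bind_congr_support fun r₁ h₁ => ?_
  refine bind_congr_support fun r h => ?_
  refine bind_congr_support fun r₂ h₂ => ?_
  rw [mem_support_bits] at *
  exact congrArg PMF.pure (hF ⟨m.length, s, m, r₀, r₁, r₂⟩ r ⟨hs, rfl, hm, h₀, h₁, h₂⟩
    rfl rfl rfl h).symm

theorem support_keyedVector {A : AHE} {κ n s : ℕ} {v : Data}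
    (hv : v ∈ ((bits (A.vecCoins κ n)).map (keyedVector A κ n s)).support) :
    ∃ r, r.length = A.vecCoins κ n ∧ v = keyedVector A κ n s r := by
  obtain ⟨r, hr, rfl⟩ := (PMF.mem_support_map_iff _ _ _).1 hv
  exact ⟨r, mem_support_bits.1 hr, rfl⟩

/-! ### The receiver's view -/

/-- The receiver's view of the compiled protocol from its view of the underlying protocol. -/
def attachReceiver (A : AHE) (B κ : ℕ) (v d : Data) : Data :=
  -- `d` lists the input, the coins, the sender's key and the response; `v` is a `keyedVector`, that
  -- is, coins, public key and encrypted vector.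
  .node d.left (.node (listData (d.right.left.toList ++ v.left.toList))
    (.node d.right.right.left (listData (cappedCompress A B κ v.right.left
      v.right.right.toList d.right.right.right.toList))))

theorem PT.attachReceiver {ι : Type} {a v d : ι → Data} (A : AHE) {B κ : ι → ℕ}
    (hB : PT a fun i => unary (B i)) (hκ : PT a fun i => unary (κ i)) (hv : PT a v)
    (hd : PT a d) : PT a fun i => attachReceiver A (B i) (κ i) (v i) (d i) := by
  have hl : ∀ {x : ι → Data}, PT a x → PT a fun i => listData (x i).toList :=
    fun h => h.congr fun i => (listData_toList _).symm
  exact hd.left.node (((hl hd.right.left).append (hl hv.left)).node (hd.right.right.left.node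
    (PT.cappedCompress A hB hκ hv.right.left (hl hv.right.right) (hl hd.right.right.right))))

section

variable {P : VecOT} {A : AHE} {U : ℕ → Set Data} {w : ℕ → ℕ}

/-- An equality of distributions: the sender's compression uses only the response, the receiver's
public key and the encrypted vector, all available from `v` and the underlying view. -/
theorem receiverView_compile (hfit : P.Fits A U w) {B : ℕ} {κ : ℕ}
    (hB : ∀ r, r.length = A.kgenCoins κ → ∀ c ∈ A.Cipher κ (A.kgen κ r).2, c.size ≤ B)
    {m : List Data} {s : ℕ} (hs : s < m.length) (hm : ∀ x ∈ m, x ∈ U κ) :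
    (((bits (A.vecCoins κ m.length)).map (keyedVector A κ m.length s)).bind fun v =>
      (P.toOT.receiverView κ m s).map (attachReceiver A B κ v)) =
    (compile P A).receiverView κ m s := by
  refine view_eq hs hm
    (F := fun e => code ((e.n, e.s), e.r₁, P.toOT.pk κ e, P.toOT.response κ e))
    (F' := fun e => code ((e.n, e.s), e.r₁, (compile P A).pk κ e, (compile P A).response κ e))
    fun e r he hn hs hm hr => ?_
  rw [← hn] at hr ⊢
  rw [← hs]
  have h := (compile_response_spec hfit (honest_extend he hr) hB).1
  rw [keyCoins_extend he, vecCoins_extend he, inner_extend he] at h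
  show _ = Data.node (code (e.n, e.s)) (.node (listData ((code e.r₁ : Data).toList ++
    (code r : Data).toList)) (.node (P.toOT.pk κ e) (listData (cappedCompress A B κ
      (A.kgen κ (r.take (A.kgenCoins κ))).2 (listData (encOneHot A κ
        (A.kgen κ (r.take (A.kgenCoins κ))).2 e.n e.s (r.drop (A.kgenCoins κ)))).toList
      (code (P.toOT.response κ e) : Data).toList))))
  rw [code_listListData, toList_listData, toList_listData, code_bits, code_bits, toList_listData,
    toList_listData, ← List.map_append, ← code_bits]
  rw [show e.n = (e.extend r).n from rfl, show e.s = (e.extend r).s from rfl, h,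
    ← code_listData]
  rfl

/-- The simulator is given `s` and can produce key pair and encrypted vector honestly. A simulated
response need not be well formed, hence the capped inner product inside `attachReceiver`. -/
theorem compile_receiverSimulatable (hfit : P.Fits A U w) (h : P.toOT.ReceiverSimulatable U) :
    (compile P A).ReceiverSimulatable U := by
  obtain ⟨ℓ, Sim, hℓ, hSim, hind⟩ := h
  obtain ⟨B, hB⟩ := A.cipher_size
  refine ⟨fun κ n => ℓ κ n + A.vecCoins κ n, fun κ n s x r =>
    attachReceiver A (B.eval κ) κ (keyedVector A κ n s (r.drop (ℓ κ n)))
      (Sim κ n s x (r.take (ℓ κ n))), ?_, ?_, fun p => ?_⟩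
  · have hin : PT (fun x : ℕ × ℕ => code x) _ := .self
    exact polyTime_iff.2 (PT.add (hℓ.pt (fun x => x) hin)
      (PT.vecCoins A (κ := fun x : ℕ × ℕ => x.1) hin.left hin.right))
  · refine polyTimeOn_iff.2 ?_
    set S : Set (ℕ × ℕ × ℕ × Data × List Bool) := {x | x.2.2.1 < x.2.1 ∧ x.2.2.2.1 ∈ U x.1 ∧
      x.2.2.2.2.length = ℓ x.1 x.2.1 + A.vecCoins x.1 x.2.1}
    set env : S → Data := fun x => code x.1
    have hin : PT env env := .self
    have hκ : PT env fun x => unary x.1.1 := hin.left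
    have hn : PT env fun x => unary x.1.2.1 := hin.right.left
    have hs : PT env fun x => unary x.1.2.2.1 := hin.right.right.left
    have hr : PT env fun x => code x.1.2.2.2.2 := hin.right.right.right.right
    have hl : PT env fun x => unary (ℓ x.1.1 x.1.2.1) :=
      hℓ.pt (fun x : S => (x.1.1, x.1.2.1)) (hκ.node hn)
    refine PT.attachReceiver A (hκ.eval B) hκ (PT.keyedVector A hκ hn hs (hl.drop_bits hr)) ?_
    exact PolyTimeOn.pt hSim (g := fun x : S => (x.1.1, x.1.2.1, x.1.2.2.1, x.1.2.2.2.1,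
      x.1.2.2.2.2.take (ℓ x.1.1 x.1.2.1)))
      (fun x => ⟨x.2.1, x.2.2.1, by
        rw [List.length_take, x.2.2.2]; exact Nat.min_eq_left (Nat.le_add_right _ _)⟩)
      (hκ.node (hn.node (hs.node (hin.right.right.right.left.node (hl.take_bits hr)))))
  · obtain ⟨q, hq⟩ := size_keyedVector A p
    refine ((hind p).bind_map (T := fun κ => attachReceiver A (B.eval κ) κ)
      (R := fun κ i => (bits (A.vecCoins κ i.1.length)).map
        (keyedVector A κ i.1.length i.2)) (q := q) ?_ ?_).congr ?_ ?_
    · have hin : PT (fun x : ℕ × Data × Data => code x) _ := .self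
      have hκ : PT (fun x : ℕ × Data × Data => code x) fun x => unary x.1 := hin.left
      exact polyTime_iff.2 (PT.attachReceiver A (hκ.eval B) hκ hin.right.left hin.right.right)
    · rintro κ i ⟨h1, _, h3⟩ v hv
      obtain ⟨r, hr, rfl⟩ := support_keyedVector hv
      exact hq κ _ _ r h3 (h1.le.trans h3) hr
    · rintro κ i -
      rw [PMF.bind_map]
      simp only [PMF.map_comp]
      exact (map_bits_add _ _ fun r r' => attachReceiver A (B.eval κ) κ
        (keyedVector A κ i.1.length i.2 r') (Sim κ i.1.length i.2 (otFun i.1 i.2).2 r)).symm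
    · rintro κ i ⟨h1, h2, -⟩
      exact receiverView_compile hfit (hB κ) h1 h2

end

/-! ### The sender's view -/

/-- The sender's view of the compiled protocol from its view of the underlying protocol, given the
receiver's public key and the encrypted vector. -/
def attachSender (pk b d : Data) : Data :=
  .node d.left (.node d.right.left (.node pk (.node d.right.right b)))

theorem PT.attachSender {ι : Type} {a pk b d : ι → Data} (hpk : PT a pk) (hb : PT a b)
    (hd : PT a d) : PT a fun i => attachSender (pk i) (b i) (d i) :=
  hd.left.node (hd.right.left.node (hpk.node (hd.right.right.node hb)))

/-- An encrypted vector splits at every position. -/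
theorem encOneHot_append (A : AHE) (κ : ℕ) (pk : Data) {k l : ℕ} (b : Bool)
    {ra rc rb : List Bool} (ha : ra.length = k * A.encCoins κ) (hc : rc.length = A.encCoins κ) :
    encOneHot A κ pk (k + (1 + l)) (if b then k else k + (1 + l)) (ra ++ (rc ++ rb)) =
      encOneHot A κ pk k k ra ++
        A.enc κ pk (A.bit κ pk b) rc :: encOneHot A κ pk l l rb := by
  unfold encOneHot
  rw [List.range_add, List.map_append, List.range_add, List.map_append]
  congr 1
  · refine List.map_congr_left fun i hi => ?_
    rw [List.mem_range] at hi
    have h1 : (i + 1) * A.encCoins κ ≤ k * A.encCoins κ := Nat.mul_le_mul_right _ hi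
    rw [add_mul, one_mul] at h1
    rw [List.drop_append_of_le_length (by omega),
      List.take_append_of_le_length (by rw [List.length_drop]; omega)]
    have h2 : i ≠ if b then k else k + (1 + l) := by split <;> omega
    have h3 : i ≠ k := by omega
    simp [h2, h3]
  · have h0 : List.range 1 = [0] := rfl
    simp only [h0, List.map_cons, List.map_nil, List.singleton_append,
      List.map_map]
    congr 1
    · have h1 : (k + 0) * A.encCoins κ = ra.length := by rw [ha, add_zero]
      rw [h1, List.drop_left, List.take_left' hc]
      cases b <;> simp
    · refine List.map_congr_left fun i hi => ?_
      rw [List.mem_range] at hi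
      -- The coins of a position behind `k` start after `ra` and `rc`, with `i` blocks of `rb`
      -- skipped.
      have h1 : (k + (1 + i)) * A.encCoins κ = ra.length + (rc.length + i * A.encCoins κ) := by
        rw [ha, hc]; ring
      simp only [Function.comp_apply, h1, ← List.drop_drop, List.drop_left]
      have h2 : k + (1 + i) ≠ if b then k else k + (1 + l) := by split <;> omega
      have h3 : i ≠ l := by omega
      simp [h2, h3]

/-- Independent draws commute. In the application the order key, coins before `s`, coins at `s`,
coins after `s`, view is changed so that the advice comes first and the IND-CPA challenge last. -/
theorem bind_perm {α β γ δ ε ζ : Type} (p : PMF α) (q : PMF β) (r : PMF γ) (s : PMF δ)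
    (t : PMF ε) (f : α → β → γ → δ → ε → PMF ζ) :
    (p.bind fun a => q.bind fun b => r.bind fun c => s.bind fun d => t.bind fun e =>
        f a b c d e) =
      t.bind fun e => q.bind fun b => s.bind fun d => p.bind fun a => r.bind fun c =>
        f a b c d e := by
  rw [PMF.bind_comm t]
  rw [PMF.bind_comm p]
  refine congrArg (PMF.bind q) (funext fun b => ?_)
  rw [PMF.bind_comm t]
  have h : ∀ a, (r.bind fun c => s.bind fun d => t.bind fun e => f a b c d e) =
      s.bind fun d => t.bind fun e => r.bind fun c => f a b c d e := by
    intro a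
    rw [PMF.bind_comm]
    refine congrArg (PMF.bind s) (funext fun d => ?_)
    rw [PMF.bind_comm]
  simp only [h]
  rw [PMF.bind_comm p]
  refine congrArg (PMF.bind s) (funext fun d => ?_)
  rw [PMF.bind_comm p]

/-- Encryptions of zero; their number and the coins are read from a tree. -/
def encZeros (A : AHE) (κ : ℕ) (pk x : Data) : List Data :=
  encOneHot A κ pk x.left.toList.length x.left.toList.length x.right.toBits

/-- The sender's view with the ciphertext `c` at one position of the encrypted vector, and
encryptions of zero elsewhere. -/
def plugSender (A : AHE) (κ : ℕ) (v pk c : Data) : Data :=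
  attachSender pk (listData (encZeros A κ pk v.right.left ++
    c :: encZeros A κ pk v.right.right)) v.left

theorem plugSender_polyTime (A : AHE) : PolyTime fun x : ℕ × Data × Data × Data =>
    plugSender A x.1 x.2.1 x.2.2.1 x.2.2.2 := by
  have hin : PT (fun x : ℕ × Data × Data × Data => code x) _ := .self
  have hκ : PT (fun x : ℕ × Data × Data × Data => code x) fun x => unary x.1 := hin.left
  have hz : ∀ {x : ℕ × Data × Data × Data → Data},
      PT (fun x : ℕ × Data × Data × Data => code x) x →
      PT (fun x : ℕ × Data × Data × Data => code x)
        fun i => listData (encZeros A i.1 i.2.2.1 (x i)) := by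
    intro x hx
    have hl := PT.length (hx.left.congr fun i => (listData_toList _).symm)
    exact hκ.encOneHot A hin.right.right.left hl hl hx.right.toBits
  have hv : PT (fun x : ℕ × Data × Data × Data => code x) fun x => x.2.1 := hin.right.left
  exact polyTime_iff.2 (hin.right.right.left.attachSender
    ((hz hv.right.left).append (hin.right.right.right.node (hz hv.right.right))) hv.left)

/-- The sender's view and all coins for the encrypted vector but those at position `s`. -/
noncomputable def plugAdvice (A : AHE) (κ n s : ℕ) (V : PMF Data) : PMF Data :=
  V.bind fun d => (bits (s * A.encCoins κ)).bind fun ra =>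
    (bits ((n - s - 1) * A.encCoins κ)).bind fun rb =>
      PMF.pure (.node d (.node (.node (unary s) (code ra)) (.node (unary (n - s - 1)) (code rb))))

theorem toList_unary_length (n : ℕ) : (unary n).toList.length = n := by
  rw [unary_eq_listData, toList_listData, List.length_replicate]

/-- Index `n` is out of range and gives the zero vector, so the cases of `b` differ only in the
plaintext at position `s`. Everything else is advice or is computed from the public key. -/
theorem keyedVector_bind_eq_plugAdvice (A : AHE) {κ n s : ℕ} (hs : s < n) (V : PMF Data)
    (b : Bool) :
    (((bits (A.vecCoins κ n)).map (keyedVector A κ n (if b then s else n))).bind fun v =>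
      V.map (attachSender v.right.left v.right.right)) =
    (plugAdvice A κ n s V).bind fun v => (bits (A.kgenCoins κ)).bind fun r =>
      (bits (A.encCoins κ)).map fun r' => plugSender A κ v (A.kgen κ r).2
        (A.enc κ (A.kgen κ r).2 (A.bit κ (A.kgen κ r).2 b) r') := by
  -- `l` is the number of positions after `s`.
  obtain ⟨l, rfl⟩ : ∃ l, n = s + (1 + l) := ⟨n - s - 1, by omega⟩
  have hl : s + (1 + l) - s - 1 = l := by omega
  rw [PMF.bind_map]
  simp only [plugAdvice, PMF.bind_bind, PMF.pure_bind, PMF.map, Function.comp_def, hl]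
  rw [← bind_perm, AHE.vecCoins, bind_bits_add]
  refine bind_congr_support fun rk hk => ?_
  rw [show (s + (1 + l)) * A.encCoins κ = s * A.encCoins κ + (A.encCoins κ + l * A.encCoins κ) by
    ring, bind_bits_add]
  refine bind_congr_support fun ra ha => ?_
  rw [bind_bits_add]
  refine bind_congr_support fun rc hc => ?_
  refine bind_congr_support fun rb hb => ?_
  refine congrArg (PMF.bind V) (funext fun d => congrArg PMF.pure ?_)
  rw [mem_support_bits] at hk ha hc hb
  simp only [keyedVector, plugSender, encZeros, Data.left, Data.right, toList_unary_length,
    toBits_code, List.take_left' hk, List.drop_left' hk]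
  rw [encOneHot_append A κ _ b ha hc]

section

variable {P : VecOT} {A : AHE} {U : ℕ → Set Data}

theorem senderView_compile {κ : ℕ} {m : List Data} {s : ℕ} (hs : s < m.length)
    (hm : ∀ x ∈ m, x ∈ U κ) :
    (((bits (A.vecCoins κ m.length)).map (keyedVector A κ m.length s)).bind fun v =>
      (P.toOT.senderView κ m s).map (attachSender v.right.left v.right.right)) =
    (compile P A).senderView κ m s := by
  refine view_eq (T := fun v => attachSender v.right.left v.right.right) hs hm
    (F := fun e => code (e.m, (e.r₀, e.r₂), P.toOT.query κ e))
    (F' := fun e => code (e.m, (e.r₀, e.r₂), (compile P A).query κ e))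
    fun e r he hn hs hm hr => ?_
  rw [← hn, ← hs]
  simp only [compile_query]
  rw [keyCoins_extend he, vecCoins_extend he, inner_extend he]
  simp only [keyedVector, Data.right, Data.left]
  rw [← code_listData]
  rfl

/-- Non-uniform advice must have polynomial length; this uses the size bounds on messages, coins and
queries. -/
theorem plugAdvice_size {σ : Polynomial ℕ} (hU : ∀ κ, ∀ x ∈ U κ, x.size ≤ σ.eval κ)
    (heff : P.Efficient U) (A : AHE) (p : Polynomial ℕ) :
    ∃ q : Polynomial ℕ, ∀ κ, ∀ i ∈ inputs U p κ,
      ∀ v ∈ (plugAdvice A κ i.1.length i.2 (P.toOT.senderView κ i.1 i.2)).support,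
        v.size ≤ q.eval κ := by
  let ι := {x : (ℕ × Exec) × List Bool × List Bool //
    P.toOT.Honest U x.1.1 x.1.2 ∧ x.1.2.n ≤ p.eval x.1.1 ∧
    x.2.1.length = x.1.2.s * A.encCoins x.1.1 ∧
    x.2.2.length = (x.1.2.n - x.1.2.s - 1) * A.encCoins x.1.1}
  let κ : ι → ℕ := fun i => i.1.1.1
  let e : ι → Exec := fun i => i.1.1.2
  have he : ∀ i, P.toOT.Honest U (κ i) (e i) := fun i => i.2.1
  have hn : ∀ i, (e i).n ≤ p.eval (κ i) := fun i => i.2.2.1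
  have hκ : PolyBound κ κ := .self
  have hn' : PolyBound κ fun i => (e i).n := (hκ.eval p).mono hn
  have hs : PolyBound κ fun i => (e i).s := hn'.mono fun i => (he i).1.le
  have hl : PolyBound κ fun i => (e i).n - (e i).s - 1 := hn'.mono fun i => by omega
  have hc : PolyBound κ fun i => A.encCoins (κ i) := PolyBound.nat A.encCoins_polyTime hκ
  have hra : PolyBound κ fun i => i.1.2.1.length := (hs.mul hc).mono fun i => i.2.2.2.1.le
  have hrb : PolyBound κ fun i => i.1.2.2.length := (hl.mul hc).mono fun i => i.2.2.2.2.le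
  have hm := size_messages hU he hn
  obtain ⟨q, hq⟩ := (hm.size_node (((heff.toOT.size_r₀ he).size_node
    (heff.toOT.size_r₂ he hn)).size_node (heff.toOT.size_query he hn))).size_node
    ((hs.size_unary.size_node hra.size_bits).size_node (hl.size_unary.size_node hrb.size_bits))
  refine ⟨q, ?_⟩
  rintro κ ⟨m, s⟩ ⟨h1, h2, h3⟩ v hv
  simp only [plugAdvice, PMF.mem_support_bind_iff, PMF.mem_support_pure_iff] at hv
  obtain ⟨d, hd, ra, ha, rb, hb, rfl⟩ := hv
  rw [OT.senderView] at hd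
  obtain ⟨r₀, h₀, hd⟩ := (PMF.mem_support_bind_iff _ _ _).1 hd
  obtain ⟨r₁, h₁, hd⟩ := (PMF.mem_support_bind_iff _ _ _).1 hd
  obtain ⟨r₂, h₂, hd⟩ := (PMF.mem_support_bind_iff _ _ _).1 hd
  obtain rfl := (PMF.mem_support_pure_iff _ _).1 hd
  rw [mem_support_bits] at h₀ h₁ h₂ ha hb
  exact hq ⟨((κ, ⟨m.length, s, m, r₀, r₁, r₂⟩), ra, rb), ⟨h1, rfl, h2, h₀, h₁, h₂⟩, h3, ha, hb⟩

/-- Two hops: from the simulated to the real underlying view, both with a zero vector, and then from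
the zero vector to the one-hot vector next to the real view. -/
theorem compile_senderSimulatable {σ : Polynomial ℕ} (hU : ∀ κ, ∀ x ∈ U κ, x.size ≤ σ.eval κ)
    (heff : P.Efficient U) (hcpa : A.INDCPA) (h : P.toOT.SenderSimulatable U) :
    (compile P A).SenderSimulatable U := by
  obtain ⟨ℓ, Sim, hℓ, hSim, hind⟩ := h
  refine ⟨fun κ n => ℓ κ n + A.vecCoins κ n, fun κ m r =>
    let v := keyedVector A κ m.length m.length (r.drop (ℓ κ m.length))
    attachSender v.right.left v.right.right (Sim κ m (r.take (ℓ κ m.length))), ?_, ?_, fun p => ?_⟩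
  · have hin : PT (fun x : ℕ × ℕ => code x) _ := .self
    exact polyTime_iff.2 (PT.add (hℓ.pt (fun x => x) hin)
      (PT.vecCoins A (κ := fun x : ℕ × ℕ => x.1) hin.left hin.right))
  · refine polyTimeOn_iff.2 ?_
    set S : Set (ℕ × List Data × List Bool) := {x | (∀ y ∈ x.2.1, y ∈ U x.1) ∧
      x.2.2.length = ℓ x.1 x.2.1.length + A.vecCoins x.1 x.2.1.length}
    set env : S → Data := fun x => code x.1
    have hin : PT env env := .self
    have hκ : PT env fun x => unary x.1.1 := hin.left
    have hm : PT env fun x => listData x.1.2.1 := hin.right.left.congr fun x => code_listData _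
    have hn : PT env fun x => unary x.1.2.1.length := hm.length
    have hr : PT env fun x => code x.1.2.2 := hin.right.right
    have hl : PT env fun x => unary (ℓ x.1.1 x.1.2.1.length) :=
      hℓ.pt (fun x : S => (x.1.1, x.1.2.1.length)) (hκ.node hn)
    have hv := PT.keyedVector A hκ hn hn (hl.drop_bits hr)
    refine PT.attachSender hv.right.left hv.right.right ?_
    exact PolyTimeOn.pt hSim (g := fun x : S => (x.1.1, x.1.2.1,
      x.1.2.2.take (ℓ x.1.1 x.1.2.1.length)))
      (fun x => ⟨x.2.1, by
        rw [List.length_take, x.2.2]; exact Nat.min_eq_left (Nat.le_add_right _ _)⟩)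
      (hκ.node (hin.right.left.node (hl.take_bits hr)))
  · obtain ⟨q, hq⟩ := size_keyedVector A p
    obtain ⟨q', hq'⟩ := plugAdvice_size hU heff A p
    refine ((hind p).bind_map (T := fun _ v => attachSender v.right.left v.right.right)
      (R := fun κ i => (bits (A.vecCoins κ i.1.length)).map
        (keyedVector A κ i.1.length i.1.length)) (q := q) ?_ ?_).congr ?_ (fun _ _ _ => rfl)
      |>.trans ?_
    · have hin : PT (fun x : ℕ × Data × Data => code x) _ := .self
      have hv : PT (fun x : ℕ × Data × Data => code x) fun x => x.2.1 := hin.right.left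
      exact polyTime_iff.2 (PT.attachSender hv.right.left hv.right.right hin.right.right)
    · rintro κ i ⟨_, _, h3⟩ v hv
      obtain ⟨r, hr, rfl⟩ := support_keyedVector hv
      exact hq κ _ _ r h3 h3 hr
    · rintro κ i -
      rw [PMF.bind_map]
      simp only [PMF.map_comp]
      exact (map_bits_add _ _ fun r r' =>
        let v := keyedVector A κ i.1.length i.1.length r'
        attachSender v.right.left v.right.right (Sim κ i.1 r)).symm
    -- The second hop; `b` is false for the zero vector and true for the vector of the protocol.
    · refine (hcpa.compIndist (plugSender_polyTime A) hq' (fun b κ i => rfl)).congr ?_ ?_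
      · rintro κ i ⟨h1, -, -⟩
        exact (keyedVector_bind_eq_plugAdvice A h1 _ false).symm
      · rintro κ i ⟨h1, h2, -⟩
        exact (keyedVector_bind_eq_plugAdvice A h1 _ true).symm.trans (senderView_compile h1 h2)

end

end ThinOT


theorem theorem4
    (U : ℕ → Set Data) (σ : Polynomial ℕ)
    (hU : ∀ κ, ∀ x ∈ U κ, x.size ≤ σ.eval κ)
    (P : VecOT) (A : AHE) (w : ℕ → ℕ)
    (hfit : P.Fits A U w)
    (heff : P.Efficient U)
    (hsec : P.toOT.SecurelyComputes U)
    (hcpa : A.INDCPA) :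
    (compile P A).Efficient U ∧
    (compile P A).SecurelyComputes U ∧
    ∃ K : Polynomial ℕ, ∀ κ e, (compile P A).Honest U κ e →
      ((compile P A).response κ e).length = w κ ∧
      (Coded.code ((compile P A).response κ e)).size ≤ K.eval κ :=
  ⟨compile_efficient hfit heff, ⟨compile_correct hfit hsec.1,
    compile_senderSimulatable hU heff hcpa hsec.2.1, compile_receiverSimulatable hfit hsec.2.2⟩,
    compile_response_size hU hfit heff⟩
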